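/- Let $\ell\ge 2$ and $\nu=(\nu_1,\dots,\nu_\ell)\in\mathbb Z^\ell$, put $|\nu|=\nu_1+\cdots+\nu_\ell$, and read the indices of $\nu$ modulo $\ell$. For $0\le n\le \ell$ let $\nu(n)=\nu+(1,\dots,1,0,\dots,0)$ with $n$ ones. Let $\lambda(\nu)$ be the partition attached to the set $$\mathbf m(\nu)=(\ell\mathbb Z_{<\nu_1}+1)\cup(\ell\mathbb Z_{<\nu_2}+2)\cup\cdots\cup(\ell\mathbb Z_{<\nu_\ell}+\ell)=\{m_1>m_2>m_3>\cdots\},$$ that is, the partition $\lambda=(\lambda_1\ge\lambda_2\ge\cdots)$ with $m_i-m_{i+1}=\lambda_i-\lambda_{i+1}+1$ for all $i$. Let $S_\lambda(x_1,x_2,\dots)=\det\bigl(p_{\lambda_i-i+j}\bigr)_{1\le i,j\le l(\lambda)}$ be the Schur function, where $\sum_{n\in\mathbb Z} p_n k^n=\exp\bigl(\sum_{n\ge1}x_nk^n\bigr)$ and $l(\lambda)$ is the number of nonzero parts. Define, for $a,s\in\mathbb C$, $$\sigma_n(a,s)=S_{\lambda(\nu(n))}\Bigl(s+a,\frac a2,\frac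 a3,\frac a4,\dots\Bigr).$$ Then $\sigma_\ell=\sigma_0$, so that $\sigma_n$ makes sense for $n\in\mathbb Z/\ell\mathbb Z$, and for every $n$ and every $a\in\mathbb C$ the function $\sigma_n(a,\cdot)$ is a nonzero polynomial in $s$. Write $D_s f\cdot g=\frac{d}{d\varepsilon}f(s+\varepsilon)g(s-\varepsilon)\big|_{\varepsilon=0}$. For all $n\in\mathbb Z/\ell\mathbb Z$ and $a,s\in\mathbb C$, $$(D_s+1)\,\sigma_n(a-1,s)\cdot\sigma_{n+1}(a,s)-\sigma_n(a,s)\,\sigma_{n+1}(a-1,s)=0,$$ $$(sD_s+a+d_{n+1}-d_n)\,\sigma_n(a,s)\cdot\sigma_{n+1}(a,s)-a\,\sigma_n(a-1,s)\,\sigma_{n+1}(a+1,s)=0,$$ where $d_n\in\mathbb C$ ($n\in\mathbb Z/\ell\mathbb Z$) are any numbers with $d_{n+1}-d_n=\ell\nu_{n+1}-|\nu|$ for all $n$; such numbers exist. Consequently, for every constant $a\in\mathbb C$, the rational functions of $s$ $$f_n=\frac{\sigma_{n-1}(a,s)\,\sigma_n(a-1,s)}{\sigma_{n-1}(a-1,s)\,\sigma_n(a,s)},\qquad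 g_n=\frac{\sigma_{n-1}(a-1,s)\,\sigma_n(a+1,s)}{\sigma_{n-1}(a,s)\,\sigma_n(a,s)}\qquad(n\in\mathbb Z/\ell\mathbb Z)$$ solve the $P_{\rm III}$-chain $$s\frac{df_n}{ds}=\bigl(s(f_{n+1}-f_n)+a(g_n-g_{n+1})+\alpha_n-1\bigr)f_n,\qquad \frac{dg_n}{ds}=f_ng_n-f_{n-1}g_{n-1},$$ with $\alpha_n=\ell(\nu_{n+1}-\nu_n)+1$, at every $s$ with $\sigma_k(a,s)\,\sigma_k(a-1,s)\neq0$ for all $k\in\mathbb Z/\ell\mathbb Z$. -/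

import Mathlib

/-! ### Maya diagrams and partitions -/

/-- A Maya diagram: a set of integers containing all sufficiently small integers and no
sufficiently large one. -/
def IsMaya (m : Set ℤ) : Prop :=
  (∃ N : ℤ, ∀ i : ℤ, i ≤ N → i ∈ m) ∧ (∃ N : ℤ, ∀ i : ℤ, N ≤ i → i ∉ m)

/-- The decreasing enumeration `m₁ > m₂ > m₃ > ⋯` of a Maya diagram; `mayaSeq m i` is `m_{i+1}`. -/
noncomputable def mayaSeq (m : Set ℤ) : ℕ → ℤ
  | 0 => sSup m
  | i + 1 => sSup {x : ℤ | x ∈ m ∧ x < mayaSeq m i}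

/-- The partition of a Maya diagram; `mayaPartition m i` is the part `λ_{i+1}`, which is the number
of integers below `m_{i+1}` that do not belong to `m`. By `mayaPartition_spec` below it is the
partition with `m_i - m_{i+1} = λ_i - λ_{i+1} + 1`. -/
noncomputable def mayaPartition (m : Set ℤ) (i : ℕ) : ℕ :=
  {x : ℤ | x ∉ m ∧ x < mayaSeq m i}.ncard

theorem mayaSeq_mem {m : Set ℤ} (hm : IsMaya m) (i : ℕ) : mayaSeq m i ∈ m := by
  obtain ⟨⟨N, hN⟩, ⟨M, hM⟩⟩ := hm
  have hb : BddAbove m := ⟨M, fun x hx => by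
    by_contra h
    exact hM x (by omega) hx⟩
  cases i with
  | zero => exact Int.csSup_mem ⟨N, hN N le_rfl⟩ hb
  | succ i =>
    have h := Int.csSup_mem (s := {x : ℤ | x ∈ m ∧ x < mayaSeq m i})
      ⟨min N (mayaSeq m i - 1), hN _ (min_le_left _ _), by
        have := min_le_right N (mayaSeq m i - 1)
        omega⟩ (hb.mono fun x hx => hx.1)
    exact h.1

theorem mayaSeq_succ_lt {m : Set ℤ} (hm : IsMaya m) (i : ℕ) :
    mayaSeq m (i + 1) < mayaSeq m i := by
  obtain ⟨⟨N, hN⟩, _⟩ := hm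
  have h := Int.csSup_mem (s := {x : ℤ | x ∈ m ∧ x < mayaSeq m i})
    ⟨min N (mayaSeq m i - 1), hN _ (min_le_left _ _), by
      have := min_le_right N (mayaSeq m i - 1)
      omega⟩ ⟨mayaSeq m i, fun x hx => hx.2.le⟩
  exact h.2

theorem le_mayaSeq_succ {m : Set ℤ} (i : ℕ) {x : ℤ} (hx : x ∈ m)
    (h : x < mayaSeq m i) : x ≤ mayaSeq m (i + 1) :=
  le_csSup (s := {x : ℤ | x ∈ m ∧ x < mayaSeq m i}) ⟨mayaSeq m i, fun _ hy => hy.2.le⟩ ⟨hx, h⟩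

/-- The sequence `mayaSeq m` enumerates `m` decreasingly, and `mayaPartition m` is the partition
attached to it. -/
theorem mayaPartition_spec {m : Set ℤ} (hm : IsMaya m) :
    StrictAnti (mayaSeq m) ∧ Set.range (mayaSeq m) = m ∧ Antitone (mayaPartition m) ∧
    (∀ i, mayaSeq m i - mayaSeq m (i + 1)
      = (mayaPartition m i : ℤ) - mayaPartition m (i + 1) + 1) ∧
    (∃ k, ∀ i, k ≤ i → mayaPartition m i = 0) := by
  have hanti : StrictAnti (mayaSeq m) := strictAnti_nat_of_succ_lt (mayaSeq_succ_lt hm)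
  have hlin : ∀ i : ℕ, mayaSeq m i ≤ mayaSeq m 0 - i := by
    intro i
    induction i with
    | zero => simp
    | succ k ih =>
      have := mayaSeq_succ_lt hm k
      push_cast
      omega
  have hfin : ∀ y : ℤ, {x : ℤ | x ∉ m ∧ x < y}.Finite := by
    intro y
    obtain ⟨⟨N, hN⟩, _⟩ := hm
    refine (Set.finite_Icc N y).subset fun x hx => ⟨?_, hx.2.le⟩
    by_contra h
    exact hx.1 (hN x (by omega))
  have hdiff : ∀ i, mayaSeq m i - mayaSeq m (i + 1)
      = (mayaPartition m i : ℤ) - mayaPartition m (i + 1) + 1 := by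
    intro i
    have hlt := mayaSeq_succ_lt hm i
    have hset : {x : ℤ | x ∉ m ∧ x < mayaSeq m i} =
        {x : ℤ | x ∉ m ∧ x < mayaSeq m (i + 1)} ∪
          (Finset.Ioo (mayaSeq m (i + 1)) (mayaSeq m i) : Set ℤ) := by
      ext x
      simp only [Set.mem_ofPred_eq, Set.mem_union, Finset.coe_Ioo, Set.mem_Ioo]
      constructor
      · rintro ⟨h1, h2⟩
        rcases lt_trichotomy x (mayaSeq m (i + 1)) with h | h | h
        · exact Or.inl ⟨h1, h⟩
        · exact absurd (h ▸ mayaSeq_mem hm (i + 1)) h1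
        · exact Or.inr ⟨h, h2⟩
      · rintro (⟨h1, h2⟩ | ⟨h1, h2⟩)
        · exact ⟨h1, h2.trans hlt⟩
        · refine ⟨fun hx => ?_, h2⟩
          have := le_mayaSeq_succ i hx h2
          omega
    have hcard : mayaPartition m i = mayaPartition m (i + 1) +
        (Finset.Ioo (mayaSeq m (i + 1)) (mayaSeq m i)).card := by
      rw [mayaPartition, hset, Set.ncard_union_eq ?_ (hfin _) (Finset.finite_toSet _),
        Set.ncard_coe_finset, mayaPartition]
      rw [Set.disjoint_left]
      rintro x ⟨_, h2⟩ h3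
      simp only [Finset.coe_Ioo, Set.mem_Ioo] at h3
      omega
    rw [hcard, Int.card_Ioo]
    push_cast
    omega
  refine ⟨hanti, ?_, ?_, hdiff, ?_⟩
  · apply Set.Subset.antisymm
    · rintro _ ⟨i, rfl⟩
      exact mayaSeq_mem hm i
    · intro x hx
      by_contra hne
      have hlt : ∀ i, x < mayaSeq m i := by
        intro i
        have hne' : ∀ j, x ≠ mayaSeq m j := fun j h => hne ⟨j, h.symm⟩
        refine lt_of_le_of_ne ?_ (hne' i)
        induction i with
        | zero =>
          obtain ⟨_, ⟨M, hM⟩⟩ := hm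
          exact le_csSup ⟨M, fun y hy => by
            by_contra h
            exact hM y (by omega) hy⟩ hx
        | succ k ih => exact le_mayaSeq_succ k hx (lt_of_le_of_ne ih (hne' k))
      have h1 := hlt (mayaSeq m 0 - x).toNat
      have h2 := hlin (mayaSeq m 0 - x).toNat
      have h3 := hlt 0
      omega
  · intro i j hij
    refine Set.ncard_le_ncard (fun x hx => ⟨hx.1, hx.2.trans_le (hanti.antitone hij)⟩) (hfin _)
  · obtain ⟨⟨N, hN⟩, _⟩ := hm
    refine ⟨(mayaSeq m 0 - N).toNat, fun i hi => ?_⟩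
    have h : {x : ℤ | x ∉ m ∧ x < mayaSeq m i} = ∅ := by
      ext x
      simp only [Set.mem_ofPred_eq, Set.mem_empty_iff_false, iff_false, not_and, not_lt]
      intro hx
      have h1 := hlin i
      by_contra h2
      exact hx (hN x (by omega))
    rw [mayaPartition, h, Set.ncard_empty]

/-! An element `ν = (ν₁, …, ν_ℓ)` of `ℤ^ℓ` is written as a function `ν : ZMod ℓ → ℤ`, with `ν_i` the
value at the residue class of `i`, so that indices are read modulo `ℓ`. -/

/-- The Maya diagram `(ℓ ℤ_{<ν₁} + 1) ∪ (ℓ ℤ_{<ν₂} + 2) ∪ ⋯ ∪ (ℓ ℤ_{<ν_ℓ} + ℓ)`. -/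
def coreMaya {ℓ : ℕ} (ν : ZMod ℓ → ℤ) : Set ℤ :=
  {x : ℤ | ∃ i ∈ Finset.Icc 1 ℓ, ∃ k : ℤ, k < ν (i : ZMod ℓ) ∧ x = (ℓ : ℤ) * k + (i : ℤ)}

theorem isMaya_coreMaya {ℓ : ℕ} (hℓ : ℓ ≠ 0) (ν : ZMod ℓ → ℤ) : IsMaya (coreMaya ν) := by
  have : NeZero ℓ := ⟨hℓ⟩
  have hpos : (0 : ℤ) < ℓ := by exact_mod_cast Nat.pos_of_ne_zero hℓ
  have hB : ∀ i, |ν i| ≤ ∑ j, |ν j| := fun i =>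
    Finset.single_le_sum (f := fun j => |ν j|) (fun j _ => abs_nonneg _) (Finset.mem_univ i)
  set B := ∑ j, |ν j| with hBdef
  constructor
  · refine ⟨-(ℓ * (B + 1)), fun x hx => ?_⟩
    have h0 := Int.emod_nonneg (x - 1) hpos.ne'
    have h1 := Int.emod_lt_of_pos (x - 1) hpos
    have h2 := Int.mul_ediv_add_emod (x - 1) ℓ
    refine ⟨((x - 1) % ℓ).toNat + 1, ?_, (x - 1) / ℓ, ?_, ?_⟩
    · rw [Finset.mem_Icc]
      omega
    · have h3 := neg_abs_le (ν ((((x - 1) % ℓ).toNat + 1 : ℕ) : ZMod ℓ))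
      have h4 := hB ((((x - 1) % ℓ).toNat + 1 : ℕ) : ZMod ℓ)
      have h5 : (x - 1) / ℓ < -B := by
        rw [Int.ediv_lt_iff_lt_mul hpos]
        nlinarith
      omega
    · push_cast
      omega
  · refine ⟨ℓ * (B + 1) + 1, ?_⟩
    rintro x hx ⟨i, hi, k, hk, rfl⟩
    rw [Finset.mem_Icc] at hi
    have h3 := le_abs_self (ν (i : ZMod ℓ))
    have h4 := hB (i : ZMod ℓ)
    have h5 : k ≤ B - 1 := by omega
    have h6 : (ℓ : ℤ) * k ≤ ℓ * (B - 1) := mul_le_mul_of_nonneg_left h5 hpos.le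
    have h7 : (i : ℤ) ≤ ℓ := by exact_mod_cast hi.2
    nlinarith

/-- The `ℓ`-core partition `λ(ν)`; its part `λ_{i+1}` is `corePartition ν i`. -/
noncomputable def corePartition {ℓ : ℕ} (ν : ZMod ℓ → ℤ) : ℕ → ℕ :=
  mayaPartition (coreMaya ν)

open Classical in
/-- `ν(n) = ν + (1, …, 1, 0, …, 0)` with `n` ones, for `0 ≤ n ≤ ℓ`. -/
noncomputable def nuShift {ℓ : ℕ} (ν : ZMod ℓ → ℤ) (n : ℕ) : ZMod ℓ → ℤ :=
  fun i => ν i + if ∃ j ∈ Finset.Icc 1 n, (j : ZMod ℓ) = i then 1 else 0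

/-- `|ν| = ν₁ + ν₂ + ⋯ + ν_ℓ`. -/
def nuSum {ℓ : ℕ} (ν : ZMod ℓ → ℤ) : ℤ := ∑ i ∈ Finset.Icc 1 ℓ, ν (i : ZMod ℓ)

/-! ### Schur functions -/

/-- The polynomial `p_n(x₁, x₂, …)`, that is, `0` for `n < 0` and
`∑_{k₁ + 2 k₂ + ⋯ + n k_n = n} x₁^{k₁} ⋯ x_n^{k_n} / (k₁! ⋯ k_n!)` for `n ≥ 0`. The variable `x_i` is
`MvPolynomial.X i` for `i ≥ 1` (the variable of index `0` does not occur), and `k_{i+1}` is `k i`. -/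
noncomputable def schurP (n : ℤ) : MvPolynomial ℕ ℂ :=
  if n < 0 then 0 else
    ∑ k ∈ (Fintype.piFinset fun _ : Fin n.toNat => Finset.range (n.toNat + 1)) with
        ∑ i : Fin n.toNat, ((i : ℕ) + 1) * k i = n.toNat,
      ∏ i : Fin n.toNat, MvPolynomial.C (1 / ((k i).factorial : ℂ)) * MvPolynomial.X ((i : ℕ) + 1) ^ k i

/-- The length of a partition: the number of its nonzero parts. -/
noncomputable def partLength (lam : ℕ → ℕ) : ℕ := {i : ℕ | lam i ≠ 0}.ncard

/-- The Schur function `S_λ(x) = det (p_{λ_i - i + j}(x))_{1 ≤ i, j ≤ l(λ)}`. -/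
noncomputable def schurS (lam : ℕ → ℕ) : MvPolynomial ℕ ℂ :=
  Matrix.det (Matrix.of fun i j : Fin (partLength lam) =>
    schurP ((lam i : ℤ) - ((i : ℕ) : ℤ) + ((j : ℕ) : ℤ)))

/-- The point `x = (s + a, a/2, a/3, a/4, …)`. -/
noncomputable def specPoint (a s : ℂ) : ℕ → ℂ := fun n => if n = 1 then s + a else a / n

/-- `σ_n(a, s) = S_{λ(ν(n))}(s + a, a/2, a/3, …)` for `0 ≤ n ≤ ℓ`. -/
noncomputable def sigmaNat {ℓ : ℕ} (ν : ZMod ℓ → ℤ) (n : ℕ) (a s : ℂ) : ℂ :=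
  MvPolynomial.eval (specPoint a s) (schurS (corePartition (nuShift ν n)))

/-- The cyclic sequence `σ_n(a, s)`, `n ∈ ℤ/ℓℤ`, through the representatives `0, …, ℓ - 1`. -/
noncomputable def sigma {ℓ : ℕ} (ν : ZMod ℓ → ℤ) (n : ZMod ℓ) (a s : ℂ) : ℂ :=
  sigmaNat ν n.val a s

/-! ### Bilinear equations and the chain -/

/-- The Hirota derivative `D_s f · g`, at the point `s`. -/
noncomputable def hirotaD (f g : ℂ → ℂ) (s : ℂ) : ℂ :=
  deriv (fun ε : ℂ => f (s + ε) * g (s - ε)) 0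

/-- `f_n(a, s) = σ_{n-1}(a,s) σ_n(a-1,s) / (σ_{n-1}(a-1,s) σ_n(a,s))`. -/
noncomputable def chainF {ℓ : ℕ} (σ : ZMod ℓ → ℂ → ℂ → ℂ) (a : ℂ) (n : ZMod ℓ) (s : ℂ) : ℂ :=
  (σ (n - 1) a s * σ n (a - 1) s) / (σ (n - 1) (a - 1) s * σ n a s)

/-- `g_n(a, s) = σ_{n-1}(a-1,s) σ_n(a+1,s) / (σ_{n-1}(a,s) σ_n(a,s))`. -/
noncomputable def chainG {ℓ : ℕ} (σ : ZMod ℓ → ℂ → ℂ → ℂ) (a : ℂ) (n : ZMod ℓ) (s : ℂ) : ℂ :=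
  (σ (n - 1) (a - 1) s * σ n (a + 1) s) / (σ (n - 1) a s * σ n a s)

/-- The functions `f_n`, `g_n` (`n ∈ ℤ/ℓℤ`) of `s` are differentiable at `s` and satisfy there the
`P_III`-chain with constant `a` and parameters `α_n`. -/
def SolvesP3ChainAt {ℓ : ℕ} (a : ℂ) (α : ZMod ℓ → ℂ) (f g : ZMod ℓ → ℂ → ℂ) (s : ℂ) : Prop :=
  ∀ n : ZMod ℓ,
    DifferentiableAt ℂ (f n) s ∧ DifferentiableAt ℂ (g n) s ∧
    s * deriv (f n) s =
      (s * (f (n + 1) s - f n s) + a * (g n s - g (n + 1) s) + α n - 1) * f n s ∧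
    deriv (g n) s = f n s * g n s - f (n - 1) s * g (n - 1) s

/-!
At the point `(s + a, a/2, a/3, …)` the generating series of the `p_n` is `exp (s T) (1 - T)^{-a}`
(`eval_schurP_specPoint`). Hence the values `h_n(a, s)` satisfy three contiguity relations:
`h_n(a) - h_{n-1}(a) = h_n(a - 1)`, `∂_s h_n = h_{n-1}` and
`n h_n(a) = s h_{n-1}(a) + a h_{n-1}(a + 1)`.

The Schur function of a Maya diagram containing all integers up to `b` is, up to a sign, the
determinant `det (h_{u_i - j})` on its elements `b + 1 + u_i` above `b`
(`exists_sign_eval_schurS_mayaPartition`), a Wronskian in `s`. Passing from `ν(n)` to `ν(n+1)` adds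
one element to the Maya diagram, that is, one row and one column to the determinant. The bilinear
equations hold for every such pair of determinants. To see this, all determinants involved are
written in terms of the Cramer coordinates, with respect to the columns `e_0, …, e_N` of the larger
one, of two vectors: the first column `f` with `a` raised by one, and the unit vector `ω` of the
additional row. By Jacobi's identity (`Matrix.det_mul_det_updateCol_updateCol`), a determinant in
which both `f` and `ω` occur is a `2 × 2` minor of these coordinates. The first equation is then a
three-term Plücker relation (`det_tauMatrix_bilinear_one`). For the second one, the third contiguity
relation, applied to one column at a time, gives an Euler relation for each determinant
(`mul_deriv_det_tauMatrix`), and the difference of the two is again a quadratic identity between the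
coordinates (`det_tauMatrix_bilinear_two`). The constant in it is the position of the added element
relative to the charge of the diagram, which is counted in `exists_enumeration_coreMaya`.

As a polynomial in `s`, the determinant has the leading coefficient `det (1 / (u_i - j)!)`, a
Vandermonde determinant, so it does not vanish identically. Finally `ν(ℓ)` gives the translate by `ℓ`
of the diagram of `ν(0)`, hence the same partition, and the chain follows from the bilinear
equations by logarithmic differentiation (`solvesP3ChainAt_of_bilinear`).
-/

/-! ### The polynomials `p_n` at the special point -/

/-- The factor `exp (x_{i+1} T^{i+1})` of the generating series of the `p_n`. -/
noncomputable def expFactor (x : ℕ → ℂ) (i : ℕ) : PowerSeries ℂ :=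
  PowerSeries.mk fun m =>
    if (i + 1) ∣ m then x (i + 1) ^ (m / (i + 1)) / ((m / (i + 1)).factorial : ℂ) else 0

theorem coeff_mul_succ_expFactor (x : ℕ → ℂ) (i q : ℕ) :
    PowerSeries.coeff ((i + 1) * q) (expFactor x i) = x (i + 1) ^ q / (q.factorial : ℂ) := by
  simp [expFactor]

theorem derivative_expFactor (x : ℕ → ℂ) (i : ℕ) :
    PowerSeries.derivative ℂ (expFactor x i) =
      (PowerSeries.C (((i : ℂ) + 1) * x (i + 1)) * PowerSeries.X ^ i) * expFactor x i := by
  ext m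
  rw [PowerSeries.coeff_derivative, mul_assoc, PowerSeries.coeff_C_mul,
    PowerSeries.coeff_X_pow_mul']
  by_cases hd : (i + 1) ∣ (m + 1)
  · obtain ⟨q, hq⟩ := hd
    obtain _ | q := q
    · omega
    have h1 : m - i = (i + 1) * q := by rw [mul_add] at hq; omega
    have h2 : i ≤ m := by rw [mul_add] at hq; omega
    rw [if_pos h2, h1, hq, coeff_mul_succ_expFactor, coeff_mul_succ_expFactor]
    have h3 : (m : ℂ) + 1 = ((i : ℂ) + 1) * (q + 1) := by exact_mod_cast hq
    have h4 : (q.factorial : ℂ) ≠ 0 := by exact_mod_cast q.factorial_ne_zero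
    have h5 : (q : ℂ) + 1 ≠ 0 := by exact_mod_cast q.succ_ne_zero
    rw [h3, Nat.factorial_succ]
    push_cast
    field_simp
    ring
  · have h1 : PowerSeries.coeff (m + 1) (expFactor x i) = 0 := by simp [expFactor, hd]
    rw [h1, zero_mul]
    split_ifs with h
    · have h2 : ¬ (i + 1) ∣ (m - i) := fun h3 => hd (by
        have := Dvd.dvd.add h3 (dvd_refl (i + 1))
        rwa [show m - i + (i + 1) = m + 1 by omega] at this)
      simp [expFactor, h2]
    · simp

theorem derivative_prod_expFactor (x : ℕ → ℂ) (K : ℕ) :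
    PowerSeries.derivative ℂ (∏ i ∈ Finset.range K, expFactor x i) =
      (∑ i ∈ Finset.range K, PowerSeries.C (((i : ℂ) + 1) * x (i + 1)) * PowerSeries.X ^ i) *
        ∏ i ∈ Finset.range K, expFactor x i := by
  induction K with
  | zero => simp
  | succ K ih =>
    rw [Finset.prod_range_succ, Derivation.leibniz, ih, derivative_expFactor, Finset.sum_range_succ]
    simp only [smul_eq_mul]
    ring

/-- `p_n` is the coefficient of `T^n` in the generating series; the factors of index at least `n` do
not contribute to it. -/
theorem eval_schurP_eq_coeff (x : ℕ → ℂ) (n : ℕ) :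
    MvPolynomial.eval x (schurP n) =
      PowerSeries.coeff n (∏ i ∈ Finset.range n, expFactor x i) := by
  rw [Finset.prod_range, PowerSeries.coeff_prod, schurP, if_neg (by omega), map_sum]
  simp only [Int.toNat_natCast, map_prod, map_mul, MvPolynomial.eval_C, map_pow, MvPolynomial.eval_X]
  symm
  rw [← Finset.sum_filter_of_ne (p := fun l : Fin n →₀ ℕ => ∀ i : Fin n, ((i : ℕ) + 1) ∣ l i)]
  · refine Finset.sum_bij' (fun l _ i => l i / ((i : ℕ) + 1))
      (fun k _ => Finsupp.equivFunOnFinite.symm fun i => ((i : ℕ) + 1) * k i) ?_ ?_ ?_ ?_ ?_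
    · intro l hl
      simp only [Finset.mem_filter, Finset.mem_finsuppAntidiag] at hl
      obtain ⟨⟨h1, -⟩, h2⟩ := hl
      simp only [Finset.mem_filter, Fintype.mem_piFinset, Finset.mem_range]
      refine ⟨fun i => ?_, ?_⟩
      · have : l i ≤ n := by
          refine le_of_le_of_eq ?_ h1
          exact Finset.single_le_sum (f := fun i => l i) (fun _ _ => Nat.zero_le _) (Finset.mem_univ i)
        have := Nat.div_le_self (l i) ((i : ℕ) + 1)
        omega
      · refine Eq.trans ?_ h1
        exact Finset.sum_congr rfl fun i _ => Nat.mul_div_cancel' (h2 i)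
    · intro k hk
      simp only [Finset.mem_filter] at hk
      simp only [Finset.mem_filter, Finset.mem_finsuppAntidiag]
      exact ⟨⟨hk.2, Finset.subset_univ _⟩, fun i => dvd_mul_right _ _⟩
    · intro l hl
      simp only [Finset.mem_filter] at hl
      ext i
      exact Nat.mul_div_cancel' (hl.2 i)
    · intro k _
      funext i
      simp
    · intro l hl
      simp only [Finset.mem_filter] at hl
      refine Finset.prod_congr rfl fun i _ => ?_
      obtain ⟨q, hq⟩ := hl.2 i
      simp only [hq, coeff_mul_succ_expFactor]
      rw [Nat.mul_div_cancel_left _ (Nat.succ_pos _)]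
      ring
  · intro l _ hne i
    by_contra hd
    exact hne (Finset.prod_eq_zero (Finset.mem_univ i) (by simp [expFactor, hd]))

/-- The coefficients of `(1 - T)^{-a}`. -/
noncomputable def negBinom (a : ℂ) (m : ℕ) : ℂ :=
  (ascPochhammer ℂ m).eval a / (m.factorial : ℂ)

/-- The series `exp (s T) (1 - T)^{-a}`, the generating series of the `p_n` at `specPoint a s`. -/
noncomputable def genSeries (a s : ℂ) : PowerSeries ℂ :=
  PowerSeries.mk (fun k => s ^ k / (k.factorial : ℂ)) * PowerSeries.mk (negBinom a)

theorem one_sub_X_mul_negBinom (a : ℂ) :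
    (1 - PowerSeries.X) * PowerSeries.mk (negBinom a) = PowerSeries.mk (negBinom (a - 1)) := by
  ext m
  rw [sub_mul, one_mul, map_sub]
  obtain _ | m := m
  · simp [negBinom]
  · rw [PowerSeries.coeff_succ_X_mul]
    simp only [PowerSeries.coeff_mk, negBinom]
    have h4 : (m.factorial : ℂ) ≠ 0 := by exact_mod_cast m.factorial_ne_zero
    have h5 : (m : ℂ) + 1 ≠ 0 := by exact_mod_cast m.succ_ne_zero
    have h1 : (ascPochhammer ℂ (m + 1)).eval a = (ascPochhammer ℂ m).eval a * (a + m) := by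
      simp [ascPochhammer_succ_right]
    have h2 : (ascPochhammer ℂ (m + 1)).eval (a - 1) = (a - 1) * (ascPochhammer ℂ m).eval a := by
      simp [ascPochhammer_succ_left]
    rw [h1, h2, Nat.factorial_succ]
    push_cast
    field_simp
    ring

theorem one_sub_X_mul_genSeries (a s : ℂ) :
    (1 - PowerSeries.X) * genSeries a s = genSeries (a - 1) s := by
  rw [genSeries, genSeries, mul_left_comm, one_sub_X_mul_negBinom]

theorem derivative_genSeries (a s : ℂ) :
    PowerSeries.derivative ℂ (genSeries a s) =
      PowerSeries.C s * genSeries a s + PowerSeries.C a * genSeries (a + 1) s := by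
  have h1 : PowerSeries.derivative ℂ (PowerSeries.mk fun k => s ^ k / (k.factorial : ℂ)) =
      PowerSeries.C s * PowerSeries.mk fun k => s ^ k / (k.factorial : ℂ) := by
    ext m
    rw [PowerSeries.coeff_derivative, PowerSeries.coeff_C_mul]
    simp only [PowerSeries.coeff_mk]
    have h4 : (m.factorial : ℂ) ≠ 0 := by exact_mod_cast m.factorial_ne_zero
    have h5 : (m : ℂ) + 1 ≠ 0 := by exact_mod_cast m.succ_ne_zero
    rw [Nat.factorial_succ]
    push_cast
    field_simp
    ring
  have h2 : PowerSeries.derivative ℂ (PowerSeries.mk (negBinom a)) =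
      PowerSeries.C a * PowerSeries.mk (negBinom (a + 1)) := by
    ext m
    rw [PowerSeries.coeff_derivative, PowerSeries.coeff_C_mul]
    simp only [PowerSeries.coeff_mk, negBinom]
    have h4 : (m.factorial : ℂ) ≠ 0 := by exact_mod_cast m.factorial_ne_zero
    have h5 : (m : ℂ) + 1 ≠ 0 := by exact_mod_cast m.succ_ne_zero
    have h2 : (ascPochhammer ℂ (m + 1)).eval a = a * (ascPochhammer ℂ m).eval (a + 1) := by
      simp [ascPochhammer_succ_left]
    rw [h2, Nat.factorial_succ]
    push_cast
    field_simp
  rw [genSeries, genSeries, Derivation.leibniz, h1, h2]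
  simp only [smul_eq_mul]
  ring

theorem derivative_genSeries_eq_mul (a s : ℂ) :
    PowerSeries.derivative ℂ (genSeries a s) =
      PowerSeries.mk (fun i => if i = 0 then s + a else a) * genSeries a s := by
  have h1 : genSeries (a + 1) s = PowerSeries.mk 1 * genSeries a s := by
    have h := one_sub_X_mul_genSeries (a + 1) s
    rw [add_sub_cancel_right] at h
    rw [← h, ← mul_assoc, PowerSeries.mk_one_mul_one_sub_eq_one, one_mul]
  have h2 : (PowerSeries.mk fun i => if i = 0 then s + a else a) =
      PowerSeries.C s + PowerSeries.C a * PowerSeries.mk 1 := by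
    ext i
    rw [map_add, PowerSeries.coeff_C_mul, PowerSeries.coeff_C]
    by_cases h : i = 0 <;> simp [h]
  rw [derivative_genSeries, h1, h2]
  ring

theorem eval_schurP_specPoint (a s : ℂ) (n : ℕ) :
    MvPolynomial.eval (specPoint a s) (schurP n) = PowerSeries.coeff n (genSeries a s) := by
  rw [eval_schurP_eq_coeff]
  -- Both series solve the same differential equation up to the order `K`.
  suffices h : ∀ n K : ℕ, n ≤ K →
      PowerSeries.coeff n (∏ i ∈ Finset.range K, expFactor (specPoint a s) i) =
        PowerSeries.coeff n (genSeries a s) from h n n le_rfl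
  intro n
  induction n using Nat.strong_induction_on with
  | _ n ih =>
  intro K hK
  obtain _ | n := n
  · simp [genSeries, expFactor, negBinom, PowerSeries.coeff_zero_eq_constantCoeff,
      map_prod]
  · have h5 : (n : ℂ) + 1 ≠ 0 := by exact_mod_cast n.succ_ne_zero
    apply mul_right_cancel₀ h5
    rw [← PowerSeries.coeff_derivative, ← PowerSeries.coeff_derivative,
      derivative_prod_expFactor, derivative_genSeries_eq_mul, PowerSeries.coeff_mul,
      PowerSeries.coeff_mul]
    refine Finset.sum_congr rfl fun p hp => ?_
    rw [Finset.HasAntidiagonal.mem_antidiagonal] at hp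
    rw [ih p.2 (by omega) K (by omega)]
    congr 1
    rw [map_sum, Finset.sum_eq_single p.1]
    · rw [PowerSeries.coeff_C_mul, PowerSeries.coeff_X_pow, if_pos rfl, PowerSeries.coeff_mk, mul_one]
      by_cases h : p.1 = 0
      · simp [h, specPoint]
      · have h5 : (p.1 : ℂ) + 1 ≠ 0 := by exact_mod_cast p.1.succ_ne_zero
        simp only [specPoint, Nat.add_eq_right, h, if_false]
        push_cast
        field_simp
    · intro i _ hi
      rw [PowerSeries.coeff_C_mul, PowerSeries.coeff_X_pow, if_neg (Ne.symm hi), mul_zero]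
    · intro h
      exact absurd (Finset.mem_range.2 (by omega)) h

/-- The value of `p_n` at the point `(s + a, a/2, a/3, …)`. -/
noncomputable def schurH (n : ℤ) (a s : ℂ) : ℂ :=
  MvPolynomial.eval (specPoint a s) (schurP n)

theorem schurH_natCast (n : ℕ) (a s : ℂ) :
    schurH n a s = PowerSeries.coeff n (genSeries a s) :=
  eval_schurP_specPoint a s n

theorem schurH_of_neg {n : ℤ} (hn : n < 0) (a s : ℂ) : schurH n a s = 0 := by
  simp [schurH, schurP, hn]

theorem schurH_natCast_eq_sum (n : ℕ) (a s : ℂ) :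
    schurH n a s = ∑ p ∈ Finset.HasAntidiagonal.antidiagonal n,
      s ^ p.1 / (p.1.factorial : ℂ) * negBinom a p.2 := by
  rw [schurH_natCast, genSeries, PowerSeries.coeff_mul]
  simp

theorem schurH_zero (a s : ℂ) : schurH 0 a s = 1 := by
  have := schurH_natCast_eq_sum 0 a s
  simpa [negBinom] using this

/-- Multiplication of the generating series by `1 - T` lowers `a` by one. -/
theorem schurH_sub_schurH (n : ℤ) (a s : ℂ) :
    schurH n a s - schurH (n - 1) a s = schurH n (a - 1) s := by
  rcases lt_or_ge n 0 with hn | hn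
  · simp [schurH_of_neg hn, schurH_of_neg (show n - 1 < 0 by omega)]
  lift n to ℕ using hn
  rw [schurH_natCast, schurH_natCast, ← one_sub_X_mul_genSeries, sub_mul, one_mul, map_sub]
  obtain _ | n := n
  · rw [schurH_of_neg (by norm_num)]
    simp
  · rw [PowerSeries.coeff_succ_X_mul, ← schurH_natCast n]
    push_cast
    rw [add_sub_cancel_right]

/-- The Euler relation, from `T d/dT` on the generating series. -/
theorem natCast_mul_schurH (n : ℤ) (a s : ℂ) :
    (n : ℂ) * schurH n a s = s * schurH (n - 1) a s + a * schurH (n - 1) (a + 1) s := by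
  rcases lt_or_ge n 0 with hn | hn
  · simp [schurH_of_neg hn, schurH_of_neg (show n - 1 < 0 by omega)]
  lift n to ℕ using hn
  obtain _ | n := n
  · rw [schurH_of_neg (n := ((0 : ℕ) : ℤ) - 1) (by norm_num),
      schurH_of_neg (n := ((0 : ℕ) : ℤ) - 1) (by norm_num)]
    simp
  · have h := congrArg (PowerSeries.coeff n) (derivative_genSeries a s)
    rw [PowerSeries.coeff_derivative, map_add,
      PowerSeries.coeff_C_mul, PowerSeries.coeff_C_mul] at h
    rw [show (((n + 1 : ℕ) : ℤ) - 1) = n by push_cast; ring, schurH_natCast, schurH_natCast,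
      schurH_natCast, ← h]
    push_cast
    ring

theorem hasDerivAt_schurH (n : ℤ) (a s : ℂ) :
    HasDerivAt (fun s => schurH n a s) (schurH (n - 1) a s) s := by
  rcases lt_or_ge n 0 with hn | hn
  · simp only [schurH_of_neg hn, schurH_of_neg (show n - 1 < 0 by omega)]
    exact hasDerivAt_const _ _
  lift n to ℕ using hn
  obtain _ | n := n
  · have h : (fun s => schurH ((0 : ℕ) : ℤ) a s) = fun _ => 1 := funext fun s => schurH_zero a s
    rw [h, schurH_of_neg (by norm_num)]
    exact hasDerivAt_const _ _
  · simp only [schurH_natCast_eq_sum]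
    push_cast
    rw [add_sub_cancel_right, schurH_natCast_eq_sum]
    simp only [Finset.Nat.antidiagonal_succ, Finset.sum_cons, Finset.sum_map]
    have h : ∀ p ∈ Finset.HasAntidiagonal.antidiagonal n, HasDerivAt
        (fun s : ℂ => s ^ (p.1 + 1) / ((p.1 + 1).factorial : ℂ) * negBinom a p.2)
        (s ^ p.1 / (p.1.factorial : ℂ) * negBinom a p.2) s := by
      intro p _
      have h4 : (p.1.factorial : ℂ) ≠ 0 := by exact_mod_cast p.1.factorial_ne_zero
      have h5 : (p.1 : ℂ) + 1 ≠ 0 := by exact_mod_cast p.1.succ_ne_zero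
      refine (((hasDerivAt_pow (p.1 + 1) s).div_const _).mul_const (negBinom a p.2)).congr_deriv ?_
      rw [Nat.factorial_succ]
      push_cast
      field_simp
    have h1 := (HasDerivAt.fun_sum h).const_add (1 * negBinom a (n + 1))
    simpa [Function.comp_def] using h1

/-! ### Determinant identities -/

section Determinants

open Matrix

variable {R : Type*} [CommRing R] {n : Type*} [Fintype n] [DecidableEq n]

/-- Moving column `j` to place `i` and putting `y` in its place is replacing column `i` by `y` and
swapping the two columns. -/
theorem Matrix.det_updateCol_col_updateCol (A : Matrix n n R) {i j : n} (hij : i ≠ j) (y : n → R) :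
    ((A.updateCol i (A.col j)).updateCol j y).det = - cramer A y i := by
  have h : (A.updateCol i (A.col j)).updateCol j y =
      (A.updateCol i y).submatrix id (Equiv.swap i j) := by
    ext a b
    rcases eq_or_ne b i with rfl | hbi
    · simp [hij, hij.symm, Matrix.col_apply]
    · rcases eq_or_ne b j with rfl | hbj
      · simp
      · simp [hbi, hbj, Equiv.swap_apply_of_ne_of_ne hbi hbj]
  rw [h, det_permute', Equiv.Perm.sign_swap hij, ← cramer_apply]
  simp

/-- Jacobi's identity for two columns: a determinant with two replaced columns is, up to `det A`, a
`2 × 2` minor of the Cramer coordinates of the new columns. -/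
theorem Matrix.det_mul_det_updateCol_updateCol (A : Matrix n n R) {i j : n} (hij : i ≠ j)
    (x y : n → R) :
    A.det * ((A.updateCol i x).updateCol j y).det =
      cramer A x i * cramer A y j - cramer A x j * cramer A y i := by
  have hx : A.det • x = ∑ k, cramer A x k • A.col k := by
    rw [← mulVec_cramer, mulVec_eq_sum]
    simp [Matrix.col_def]
  have h1 : A.det * ((A.updateCol i x).updateCol j y).det =
      ∑ k, cramer A x k * ((A.updateCol i (A.col k)).updateCol j y).det := by
    have h : ∀ v, ((A.updateCol i v).updateCol j y).det = cramer (A.updateCol j y) v i := by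
      intro v
      rw [cramer_apply, updateCol_comm _ hij]
    simp only [h]
    rw [← smul_eq_mul, ← Pi.smul_apply, ← map_smul, hx, map_sum, Finset.sum_apply]
    simp
  rw [h1, Finset.sum_eq_add i j hij]
  · rw [show A.updateCol i (A.col i) = A from updateCol_eq_self A i, ← cramer_apply]
    rw [det_updateCol_col_updateCol A hij]
    ring
  · intro k _ hk
    have h0 : ((A.updateCol i (A.col k)).updateCol j y).det = 0 := by
      apply det_zero_of_column_eq hk.1
      intro a
      rw [updateCol_ne hk.2, updateCol_ne hk.1, updateCol_ne hij, updateCol_self]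
      rfl
    rw [h0, mul_zero]
  · simp
  · simp

theorem Matrix.cramer_col (A : Matrix n n R) (i j : n) :
    cramer A (A.col i) j = if j = i then A.det else 0 := by
  rw [cramer_row_self A (A.col i) i fun _ => rfl, Pi.single_apply]

/-- Replacing one column at a time by its image under a diagonal matrix multiplies the determinant
by the trace. -/
theorem Matrix.sum_cramer_mul_col (A : Matrix n n R) (u : n → R) :
    ∑ k, cramer A (fun i => u i * A i k) k = (∑ i, u i) * A.det := by
  simp only [cramer_eq_adjugate_mulVec, mulVec, dotProduct]
  rw [Finset.sum_comm, Finset.sum_mul]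
  refine Finset.sum_congr rfl fun i _ => ?_
  have h := congrFun (congrFun (mul_adjugate A) i) i
  rw [mul_apply] at h
  simp only [smul_apply, one_apply_eq, smul_eq_mul, mul_one] at h
  rw [← h, Finset.mul_sum]
  exact Finset.sum_congr rfl fun k _ => by ring

theorem Matrix.det_updateCol_last_single {N : ℕ} (A : Matrix (Fin (N + 1)) (Fin (N + 1)) R) :
    (A.updateCol (Fin.last N) (Pi.single (Fin.last N) 1)).det =
      (A.submatrix Fin.castSucc Fin.castSucc).det := by
  rw [det_succ_column _ (Fin.last N), Finset.sum_eq_single (Fin.last N)]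
  · rw [updateCol_self, Pi.single_eq_same, submatrix_updateCol_succAbove]
    rw [Fin.succAbove_last, ← two_mul, pow_mul]
    simp
  · intro b _ hb
    simp [hb]
  · simp

/-- The unitriangular matrix whose right action subtracts from each column the next one. -/
def diffMatrix (R : Type*) [CommRing R] (N : ℕ) : Matrix (Fin N) (Fin N) R :=
  of fun j k => (if j = k then 1 else 0) - (if (j : ℕ) = k + 1 then 1 else 0)

theorem det_diffMatrix (N : ℕ) : (diffMatrix R N).det = 1 := by
  rw [det_of_isLowerTriangular]
  · simp [diffMatrix]
  · intro i j hij
    have h : i < j := hij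
    have h1 : i ≠ j := h.ne
    have h2 : ¬ ((i : ℕ) = j + 1) := by
      have : (i : ℕ) < j := h
      omega
    simp [diffMatrix, h1, h2]

theorem mul_diffMatrix_castSucc {m : Type*} {N : ℕ} (A : Matrix m (Fin (N + 1)) R) (i : m) (k : Fin N) :
    (A * diffMatrix R (N + 1)) i k.castSucc = A i k.castSucc - A i k.succ := by
  have h : ∀ j : Fin (N + 1), (j : ℕ) = (k.castSucc : ℕ) + 1 ↔ j = k.succ := by
    intro j
    rw [Fin.ext_iff]
    simp
  simp [mul_apply, diffMatrix, mul_sub, Finset.sum_sub_distrib, h, -Fin.val_castSucc]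

theorem mul_diffMatrix_last {m : Type*} {N : ℕ} (A : Matrix m (Fin (N + 1)) R) (i : m) :
    (A * diffMatrix R (N + 1)) i (Fin.last N) = A i (Fin.last N) := by
  have h : ∀ j : Fin (N + 1), ¬ (j : ℕ) = (Fin.last N : ℕ) + 1 := by
    intro j
    rw [Fin.val_last]
    omega
  simp [mul_apply, diffMatrix, h, -Fin.val_last]

/-- The sum of the Cramer coordinates of a vector is its last Cramer coordinate after the columns
have been replaced by their successive differences. -/
theorem sum_cramer_eq_cramer_mul_diffMatrix {N : ℕ} (A : Matrix (Fin (N + 1)) (Fin (N + 1)) R)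
    (v : Fin (N + 1) → R) :
    ∑ j, cramer A v j = cramer (A * diffMatrix R (N + 1)) v (Fin.last N) := by
  have h1 : cramer A v = diffMatrix R (N + 1) *ᵥ cramer (A * diffMatrix R (N + 1)) v := by
    rw [cramer_eq_adjugate_mulVec, cramer_eq_adjugate_mulVec, adjugate_mul_distrib, ← mulVec_mulVec,
      mulVec_mulVec _ (diffMatrix R (N + 1)), mul_adjugate, det_diffMatrix]
    simp
  have h2 : ∀ w : Fin (N + 1) → R, ∑ j, (diffMatrix R (N + 1) *ᵥ w) j = w (Fin.last N) := by
    intro w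
    -- All columns of `diffMatrix` but the last one have sum zero.
    have h3 : ∀ k, ∑ j, diffMatrix R (N + 1) j k = if k = Fin.last N then 1 else 0 := by
      intro k
      have h4 := fun k => congrFun (congrFun (show (of fun (_ : Unit) (_ : Fin (N + 1)) => (1 : R)) *
        diffMatrix R (N + 1) = of fun _ k => ∑ j, diffMatrix R (N + 1) j k by
          ext; simp [mul_apply]) ()) k
      simp only [of_apply] at h4
      rw [← h4]
      induction k using Fin.lastCases with
      | last => rw [mul_diffMatrix_last]; simp
      | cast k => rw [mul_diffMatrix_castSucc]; simp [Fin.castSucc_ne_last]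
    simp only [mulVec, dotProduct]
    rw [Finset.sum_comm]
    simp only [← Finset.sum_mul, h3]
    simp
  rw [h1, h2]

/-- The derivative of a determinant is the sum of the determinants with one column differentiated. -/
theorem Matrix.hasDerivAt_det {A : ℂ → Matrix n n ℂ} {A' : Matrix n n ℂ} {s : ℂ}
    (h : ∀ i j, HasDerivAt (fun s => A s i j) (A' i j) s) :
    HasDerivAt (fun s => (A s).det) (∑ k, cramer (A s) (A'.col k) k) s := by
  simp only [det_apply]
  have h1 : ∀ σ ∈ (Finset.univ : Finset (Equiv.Perm n)), HasDerivAt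
      (fun s => Equiv.Perm.sign σ • ∏ i, A s (σ i) i)
      (Equiv.Perm.sign σ • ∑ k, (∏ i ∈ Finset.univ.erase k, A s (σ i) i) • A' (σ k) k) s := by
    intro σ _
    exact (HasDerivAt.fun_finsetProd fun i _ => h (σ i) i).const_smul _
  refine (HasDerivAt.fun_sum h1).congr_deriv ?_
  simp only [cramer_apply, det_apply, Finset.smul_sum]
  rw [Finset.sum_comm]
  refine Finset.sum_congr rfl fun k _ => Finset.sum_congr rfl fun σ _ => ?_
  rw [← Finset.mul_prod_erase _ _ (Finset.mem_univ k), updateCol_self, smul_eq_mul, mul_comm]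
  congr 2
  exact Finset.prod_congr rfl fun i hi => (updateCol_ne (Finset.ne_of_mem_erase hi)).symm

end Determinants

/-! ### Wronskian type determinants -/

section Tau

open Matrix

/-- The matrix with rows `h_{u}, h_{u-1}, h_{u-2}, …` for the entries `u` of a finite sequence; its
columns are successive derivatives, so that its determinant is a Wronskian in `s`. -/
noncomputable def tauMatrix {N : ℕ} (u : Fin N → ℤ) (a s : ℂ) : Matrix (Fin N) (Fin N) ℂ :=
  of fun i j => schurH (u i - (j : ℕ)) a s

/-- The column of the values `h_{u - k}`, for the entries `u` of a finite sequence. -/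
noncomputable def schurCol {N : ℕ} (u : Fin N → ℤ) (k : ℕ) (a s : ℂ) : Fin N → ℂ :=
  fun i => schurH (u i - k) a s

theorem col_tauMatrix {N : ℕ} (u : Fin N → ℤ) (a s : ℂ) (j : Fin N) :
    (tauMatrix u a s).col j = schurCol u j a s := rfl

theorem schurCol_sub_schurCol {N : ℕ} (u : Fin N → ℤ) (k : ℕ) (a s : ℂ) :
    schurCol u k a s - schurCol u (k + 1) a s = schurCol u k (a - 1) s := by
  funext i
  have h := schurH_sub_schurH (u i - k) a s
  rw [sub_sub] at h
  simpa [schurCol] using h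

theorem schurCol_add_one {N : ℕ} (u : Fin N → ℤ) (k : ℕ) (a s : ℂ) :
    schurCol u k (a + 1) s = schurCol u 0 (a + 1) s - ∑ j ∈ Finset.range k, schurCol u j a s := by
  induction k with
  | zero => simp
  | succ k ih =>
    have h := schurCol_sub_schurCol u k (a + 1) s
    rw [add_sub_cancel_right] at h
    rw [Finset.sum_range_succ, ← sub_sub, ← ih, ← h]
    abel

theorem tauMatrix_mul_diffMatrix {N : ℕ} (u : Fin (N + 1) → ℤ) (a s : ℂ) :
    tauMatrix u a s * diffMatrix ℂ (N + 1) =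
      (tauMatrix u (a - 1) s).updateCol (Fin.last N) (schurCol u N a s) := by
  ext i k
  induction k using Fin.lastCases with
  | last => simp [mul_diffMatrix_last, tauMatrix, schurCol]
  | cast k =>
    rw [mul_diffMatrix_castSucc, updateCol_ne (Fin.castSucc_ne_last k)]
    have h := congrFun (schurCol_sub_schurCol u k a s) i
    simpa [schurCol, tauMatrix] using h

/-- The values at `a + 1` are partial sums of those at `a`, so raising `a` by one only changes the
last column, up to column operations. -/
theorem det_tauMatrix_add_one {N : ℕ} (u : Fin (N + 1) → ℤ) (a s : ℂ) :
    (tauMatrix u (a + 1) s).det = cramer (tauMatrix u a s) (schurCol u 0 (a + 1) s) (Fin.last N) := by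
  have h := congrArg det (tauMatrix_mul_diffMatrix u (a + 1) s)
  rw [det_mul, det_diffMatrix, mul_one, add_sub_cancel_right, ← cramer_apply, schurCol_add_one] at h
  rw [h, map_sub, map_sum, Pi.sub_apply, Finset.sum_apply, Finset.sum_eq_zero, sub_zero]
  intro j hj
  have hj' : j < N + 1 := by
    have := Finset.mem_range.1 hj
    omega
  have h1 := cramer_col (tauMatrix u a s) ⟨j, hj'⟩ (Fin.last N)
  rw [if_neg] at h1
  · exact h1
  · intro h2
    have h3 : N = j := congrArg Fin.val h2
    have := Finset.mem_range.1 hj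
    omega

/-- A determinant over the rows `u`, as a bordered one over the rows `u, w`. -/
theorem det_updateCol_updateCol_last_snoc {N : ℕ} (u : Fin N → ℤ) (w : ℤ) (a s : ℂ) (k : Fin N)
    (j : ℕ) (b : ℂ) :
    (((tauMatrix (Fin.snoc u w : Fin (N + 1) → ℤ) a s).updateCol k.castSucc
      (schurCol (Fin.snoc u w : Fin (N + 1) → ℤ) j b s)).updateCol
        (Fin.last N) (Pi.single (Fin.last N) 1)).det =
      ((tauMatrix u a s).updateCol k (schurCol u j b s)).det := by
  rw [det_updateCol_last_single]
  congr 1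
  ext i l
  rcases eq_or_ne l k with rfl | h
  · simp [schurCol]
  · rw [submatrix_apply, updateCol_ne h, updateCol_ne (by simpa using h)]
    simp [tauMatrix]

/-- The determinant over the rows `u` is a Cramer coordinate, with respect to the larger matrix over
the rows `u, w`, of the unit vector of the row `w`. -/
theorem cramer_single_last_snoc {N : ℕ} (u : Fin N → ℤ) (w : ℤ) (a s : ℂ) :
    cramer (tauMatrix (Fin.snoc u w : Fin (N + 1) → ℤ) a s) (Pi.single (Fin.last N) 1)
      (Fin.last N) = (tauMatrix u a s).det := by
  rw [cramer_apply, det_updateCol_last_single]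
  congr 1
  ext i l
  simp [tauMatrix]

theorem hasDerivAt_schurCol {N : ℕ} (u : Fin N → ℤ) (k : ℕ) (a s : ℂ) (i : Fin N) :
    HasDerivAt (fun s => schurCol u k a s i) (schurCol u (k + 1) a s i) s := by
  have h := hasDerivAt_schurH (u i - k) a s
  rw [sub_sub] at h
  simpa [schurCol] using h

theorem hasDerivAt_det_tauMatrix {N : ℕ} (u : Fin N → ℤ) (a s : ℂ) :
    HasDerivAt (fun s => (tauMatrix u a s).det)
      (∑ k : Fin N, cramer (tauMatrix u a s) (schurCol u (k + 1) a s) k) s :=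
  hasDerivAt_det (A' := of fun i (j : Fin N) => schurCol u (j + 1) a s i)
    fun i j => hasDerivAt_schurCol u j a s i

/-- The derivative of a Wronskian is obtained by differentiating its last row. -/
theorem hasDerivAt_det_tauMatrix_succ {N : ℕ} (u : Fin (N + 1) → ℤ) (a s : ℂ) :
    HasDerivAt (fun s => (tauMatrix u a s).det)
      (cramer (tauMatrix u a s) (schurCol u (N + 1) a s) (Fin.last N)) s := by
  refine (hasDerivAt_det_tauMatrix u a s).congr_deriv ?_
  rw [Finset.sum_eq_single (Fin.last N)]
  · simp
  · intro k _ hk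
    induction k using Fin.lastCases with
    | last => exact absurd rfl hk
    | cast k =>
      have h := cramer_col (tauMatrix u a s) k.succ k.castSucc
      rw [if_neg Fin.castSucc_lt_succ.ne] at h
      simpa [col_tauMatrix] using h
  · simp

end Tau

/-! ### The bilinear equations for Wronskian type determinants -/

section Bilinear

open Matrix

/-- The first bilinear equation, as a three-term Plücker relation. -/
theorem det_tauMatrix_bilinear_one {N : ℕ} (u : Fin (N + 1) → ℤ) (w : ℤ) (a s : ℂ) :
    deriv (fun s => (tauMatrix u (a - 1) s).det) s *
        (tauMatrix (Fin.snoc u w : Fin (N + 2) → ℤ) a s).det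
      - (tauMatrix u (a - 1) s).det *
        deriv (fun s => (tauMatrix (Fin.snoc u w : Fin (N + 2) → ℤ) a s).det) s
      + (tauMatrix u (a - 1) s).det * (tauMatrix (Fin.snoc u w : Fin (N + 2) → ℤ) a s).det
      - (tauMatrix u a s).det * (tauMatrix (Fin.snoc u w : Fin (N + 2) → ℤ) (a - 1) s).det = 0 := by
  obtain ⟨b, rfl⟩ : ∃ b, a = b + 1 := ⟨a - 1, by ring⟩
  rw [add_sub_cancel_right]
  set v : Fin (N + 2) → ℤ := Fin.snoc u w with hv
  set A := tauMatrix v b s with hA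
  set L : Fin (N + 2) := Fin.last (N + 1) with hL
  set K : Fin (N + 2) := (Fin.last N).castSucc with hK
  have hKL : K ≠ L := Fin.castSucc_ne_last _
  set f : Fin (N + 2) → ℂ := schurCol v 0 (b + 1) s with hf
  set ω : Fin (N + 2) → ℂ := Pi.single L 1 with hω
  have hcolL : schurCol v (N + 1) b s = A.col L := by rw [hA, col_tauMatrix]; simp [hL]
  -- The six determinants in terms of the Cramer coordinates of `f` and `ω` with respect to `A`
  have h1 : (tauMatrix u b s).det = cramer A ω L := (cramer_single_last_snoc u w b s).symm
  have h2 : (tauMatrix v (b + 1) s).det = cramer A f L := det_tauMatrix_add_one v b s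
  have h3 : A.det * (tauMatrix u (b + 1) s).det =
      cramer A f K * cramer A ω L - cramer A f L * cramer A ω K := by
    rw [← det_mul_det_updateCol_updateCol A hKL, det_tauMatrix_add_one u b s, cramer_apply,
      ← det_updateCol_updateCol_last_snoc u w]
  have h4 : deriv (fun s => (tauMatrix u b s).det) s = - cramer A ω K := by
    rw [(hasDerivAt_det_tauMatrix_succ u b s).deriv, cramer_apply,
      ← det_updateCol_updateCol_last_snoc u w, ← hv, ← hA, hcolL]
    exact det_updateCol_col_updateCol A hKL ω
  have h5 : deriv (fun s => (tauMatrix v (b + 1) s).det) s = cramer A f L - cramer A f K := by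
    -- Differentiate `cramer A f L` column by column: only the columns `K` and `L` contribute.
    have h6 : ∀ i j, HasDerivAt (fun s => (tauMatrix v b s).updateCol L (schurCol v 0 (b + 1) s) i j)
        ((of fun i (j : Fin (N + 2)) => schurCol v (j + 1) b s i).updateCol L
          (schurCol v 1 (b + 1) s) i j) s := by
      intro i j
      rcases eq_or_ne j L with rfl | hj
      · simpa using hasDerivAt_schurCol v 0 (b + 1) s i
      · simp only [updateCol_ne hj]
        exact hasDerivAt_schurCol v j b s i
    have h7 : (fun s => (tauMatrix v (b + 1) s).det) =
        fun s => ((tauMatrix v b s).updateCol L (schurCol v 0 (b + 1) s)).det :=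
      funext fun s => (det_tauMatrix_add_one v b s).trans (cramer_apply _ _ _)
    rw [h7, (hasDerivAt_det h6).deriv, ← hA, ← hf, Finset.sum_eq_add K L hKL]
    · have h8 : schurCol v 1 (b + 1) s = f - A.col 0 := by
        have h := schurCol_sub_schurCol v 0 (b + 1) s
        rw [add_sub_cancel_right] at h
        rw [hf, hA, col_tauMatrix, Fin.val_zero, ← h]
        simp
      have h9 : cramer (A.updateCol L f) (A.col L) K = - cramer A f K := by
        rw [cramer_apply, updateCol_comm _ hKL.symm, det_updateCol_col_updateCol A hKL]
      have h10 : cramer (A.updateCol L f) (f - A.col 0) L = cramer A f L := by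
        rw [cramer_apply, updateCol_idem, ← cramer_apply, map_sub, Pi.sub_apply, cramer_col,
          if_neg (by simp [hL, Fin.ext_iff]), sub_zero]
      rw [sub_eq_add_neg, ← h9, ← h10, ← h8, ← hcolL, add_comm]
      refine congrArg₂ (· + ·)
        (congrArg (fun x => cramer (A.updateCol L f) x L) (funext fun i => ?_))
        (congrArg (fun x => cramer (A.updateCol L f) x K) (funext fun i => ?_))
      · simp
      · rw [col_apply, updateCol_ne hKL]
        simp [hK]
    · intro k _ hk
      have hk' : (k : ℕ) < N := by
        have h11 := hk.1
        have h12 := hk.2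
        rw [Ne, Fin.ext_iff] at h11 h12
        simp only [hK, hL, Fin.val_castSucc, Fin.val_last] at h11 h12
        omega
      have h13 : (⟨k + 1, by omega⟩ : Fin (N + 2)) ≠ k := by simp [Fin.ext_iff]
      have h14 : (⟨k + 1, by omega⟩ : Fin (N + 2)) ≠ L := by
        simp only [hL, Ne, Fin.ext_iff, Fin.val_last]
        omega
      have h15 := cramer_col (A.updateCol L f) ⟨k + 1, by omega⟩ k
      rw [if_neg h13.symm] at h15
      rw [← h15]
      refine congrArg (fun x => cramer (A.updateCol L f) x k) (funext fun i => ?_)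
      simp [h14, hk.2, hA, tauMatrix, schurCol]
    · simp
    · simp
  rw [h1, h2, h4, h5]
  linear_combination (-1 : ℂ) * h3

/-- The Euler relation for a Wronskian: apply to one column at a time the diagonal matrix of the
entries of `u`, whose action on a column is known from `natCast_mul_schurH`. -/
theorem mul_deriv_det_tauMatrix {N : ℕ} (u : Fin N → ℤ) (a s : ℂ) :
    s * deriv (fun s => (tauMatrix u a s).det) s =
      ((∑ i, (u i : ℂ)) - (∑ k : Fin N, ((k : ℕ) : ℂ)) + a * N) * (tauMatrix u a s).det
        - a * ∑ k, cramer (tauMatrix u a s) (schurCol u 0 (a + 1) s) k := by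
  rw [(hasDerivAt_det_tauMatrix u a s).deriv]
  set A := tauMatrix u a s with hA
  have h1 : ∀ k : Fin N, cramer A (fun i => (u i : ℂ) * A i k) k =
      ((k : ℕ) : ℂ) * A.det + s * cramer A (schurCol u (k + 1) a s) k +
        a * (cramer A (schurCol u 0 (a + 1) s) k - A.det) := by
    intro k
    have h2 : (fun i => (u i : ℂ) * A i k) = ((k : ℕ) : ℂ) • A.col k + s • schurCol u (k + 1) a s +
        a • (schurCol u 0 (a + 1) s - ∑ j ∈ Finset.range (k + 1), schurCol u j a s) := by
      rw [← schurCol_add_one]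
      funext i
      have h := natCast_mul_schurH (u i - (k : ℕ)) a s
      rw [sub_sub] at h
      simp only [hA, tauMatrix, schurCol, Pi.add_apply, Pi.smul_apply, smul_eq_mul, of_apply, col_apply]
      push_cast at h ⊢
      linear_combination h
    have h3 : ∑ j ∈ Finset.range (k + 1), cramer A (schurCol u j a s) k = A.det := by
      rw [Finset.sum_eq_single (k : ℕ)]
      · rw [← col_tauMatrix, cramer_col, if_pos rfl]
      · intro j hj hjk
        have hj' : j < N := by
          have := Finset.mem_range.1 hj
          omega
        have h4 := cramer_col A ⟨j, hj'⟩ k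
        rw [if_neg fun h => hjk (congrArg Fin.val h).symm] at h4
        exact h4
      · simp
    rw [h2]
    simp only [map_add, map_smul, map_sub, map_sum, Pi.add_apply, Pi.smul_apply, Pi.sub_apply,
      Finset.sum_apply, smul_eq_mul, h3, cramer_col, if_true]
  have h2 := sum_cramer_mul_col A fun i => (u i : ℂ)
  simp only [h1, Finset.sum_add_distrib, ← Finset.mul_sum, Finset.sum_sub_distrib,
    ← Finset.sum_mul] at h2
  simp only [Finset.sum_const, Finset.card_univ, Fintype.card_fin, nsmul_eq_mul] at h2
  linear_combination h2

/-- The second bilinear equation. The Euler relations reduce it to an identity between sums of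
products of determinants, in which each product is rewritten by Jacobi's identity. -/
theorem det_tauMatrix_bilinear_two {N : ℕ} (u : Fin N → ℤ) (w : ℤ) (a s : ℂ) :
    s * (deriv (fun s => (tauMatrix u a s).det) s *
        (tauMatrix (Fin.snoc u w : Fin (N + 1) → ℤ) a s).det
      - (tauMatrix u a s).det *
        deriv (fun s => (tauMatrix (Fin.snoc u w : Fin (N + 1) → ℤ) a s).det) s)
      + (a + (w - N)) *
        ((tauMatrix u a s).det * (tauMatrix (Fin.snoc u w : Fin (N + 1) → ℤ) a s).det)
      - a * ((tauMatrix u (a - 1) s).det *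
        (tauMatrix (Fin.snoc u w : Fin (N + 1) → ℤ) (a + 1) s).det) = 0 := by
  have e1 := mul_deriv_det_tauMatrix u a s
  have e2 := mul_deriv_det_tauMatrix (Fin.snoc u w : Fin (N + 1) → ℤ) a s
  set v : Fin (N + 1) → ℤ := Fin.snoc u w with hv
  set A := tauMatrix v a s with hA
  set L : Fin (N + 1) := Fin.last N with hL
  set f : Fin (N + 1) → ℂ := schurCol v 0 (a + 1) s with hf
  set ω : Fin (N + 1) → ℂ := Pi.single L 1 with hω
  have h1 : (tauMatrix u a s).det = cramer A ω L := (cramer_single_last_snoc u w a s).symm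
  have h2 : (tauMatrix v (a + 1) s).det = cramer A f L := det_tauMatrix_add_one v a s
  have h3 : A.det * ∑ k, cramer (tauMatrix u a s) (schurCol u 0 (a + 1) s) k =
      ∑ k : Fin N, (cramer A f k.castSucc * cramer A ω L - cramer A f L * cramer A ω k.castSucc) := by
    rw [Finset.mul_sum]
    refine Finset.sum_congr rfl fun k _ => ?_
    rw [← det_mul_det_updateCol_updateCol A (Fin.castSucc_ne_last k), cramer_apply,
      ← det_updateCol_updateCol_last_snoc u w]
  have h4 : (tauMatrix u (a - 1) s).det = ∑ k, cramer A ω k := by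
    rw [sum_cramer_eq_cramer_mul_diffMatrix, hA, tauMatrix_mul_diffMatrix, cramer_apply,
      updateCol_idem, ← cramer_apply]
    exact (cramer_single_last_snoc u w (a - 1) s).symm
  have h5 : ∑ i, (v i : ℂ) = ∑ i, (u i : ℂ) + w := by
    rw [Fin.sum_univ_castSucc]
    simp [hv]
  rw [Finset.sum_sub_distrib, ← Finset.sum_mul, ← Finset.mul_sum] at h3
  rw [h5, Fin.sum_univ_castSucc, Fin.sum_univ_castSucc (fun k => cramer A f k), ← hL] at e2
  rw [Fin.sum_univ_castSucc, ← hL] at h4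
  rw [h2, h4]
  rw [h1] at e1 ⊢
  simp only [Fin.val_castSucc, Fin.val_last, hL] at e2
  rw [← hL] at e2
  push_cast at e2
  linear_combination A.det * e1 - cramer A ω L * e2 - a * h3

end Bilinear

/-! ### Schur functions of Maya diagrams -/

section Maya

open Matrix

theorem mayaSeq_unique {m : Set ℤ} (hm : IsMaya m) {f : ℕ → ℤ} (hf : StrictAnti f)
    (hr : Set.range f = m) : mayaSeq m = f := by
  obtain ⟨h1, h2, -⟩ := mayaPartition_spec hm
  rw [← neg_inj]
  refine StrictMono.range_inj (f := -mayaSeq m) (g := -f) h1.neg hf.neg |>.1 ?_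
  ext x
  have h : -x ∈ Set.range (mayaSeq m) ↔ -x ∈ Set.range f := by rw [h2, hr]
  simpa [neg_eq_iff_eq_neg] using h

theorem mayaPartition_image_add {m : Set ℤ} (hm : IsMaya m) (c : ℤ) :
    mayaPartition ((fun x => x + c) '' m) = mayaPartition m := by
  have hm' : IsMaya ((fun x => x + c) '' m) := by
    obtain ⟨⟨N, hN⟩, M, hM⟩ := hm
    refine ⟨⟨N + c, fun i hi => ⟨i - c, hN _ (by omega), by ring⟩⟩, M + c, ?_⟩
    rintro i hi ⟨j, hj, rfl⟩
    exact hM j (by simp at hi; omega) hj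
  obtain ⟨h1, h2, -⟩ := mayaPartition_spec hm
  have hseq : mayaSeq ((fun x => x + c) '' m) = fun i => mayaSeq m i + c := by
    refine mayaSeq_unique hm' (fun i j hij => by simpa using h1 hij) ?_
    conv_rhs => rw [← h2]
    rw [← Set.range_comp]
    rfl
  funext i
  rw [mayaPartition, mayaPartition, hseq]
  symm
  refine Set.ncard_congr (fun x _ => x + c) ?_ ?_ ?_
  · rintro x ⟨hx1, hx2⟩
    exact ⟨by simpa using hx1, by simpa using hx2⟩
  · intro x y _ _ h
    simpa using h
  · rintro y ⟨hy1, hy2⟩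
    refine ⟨y - c, ⟨fun h => hy1 ⟨y - c, h, by ring⟩, by simp at hy2; omega⟩, by ring⟩

/-- The determinant defining a Schur function may be enlarged by zero parts. -/
theorem eval_schurS_eq_det {lam : ℕ → ℕ} (hlam : Antitone lam) {N : ℕ} (hN : lam N = 0) (a s : ℂ) :
    MvPolynomial.eval (specPoint a s) (schurS lam) =
      (Matrix.of fun i j : Fin N => schurH ((lam i : ℤ) - (i : ℕ) + (j : ℕ)) a s).det := by
  have hex : ∃ k, lam k = 0 := ⟨N, hN⟩
  have hlen : partLength lam = Nat.find hex := by
    have : {i : ℕ | lam i ≠ 0} = (Finset.range (Nat.find hex) : Set ℕ) := by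
      ext i
      simp only [Set.mem_ofPred_eq, Finset.coe_range, Set.mem_Iio, Nat.lt_find_iff]
      constructor
      · intro h m hm h0
        exact h (Nat.le_zero.1 (h0 ▸ hlam hm))
      · intro h
        exact h i le_rfl
    rw [partLength, this, Set.ncard_coe_finset, Finset.card_range]
  have hle : partLength lam ≤ N := hlen ▸ Nat.find_min' hex hN
  have hzero : ∀ k, partLength lam ≤ k → lam k = 0 := fun k hk =>
    Nat.le_zero.1 ((hlam hk).trans (by rw [hlen, Nat.find_spec hex]))
  clear hN
  induction N, hle using Nat.le_induction with
  | base =>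
    rw [schurS, RingHom.map_det]
    rfl
  | succ N hN ih =>
    rw [ih, det_succ_row _ (Fin.last N), Finset.sum_eq_single (Fin.last N)]
    · have h0 : schurH ((lam N : ℤ) - (N : ℕ) + (N : ℕ)) a s = 1 := by
        rw [hzero N hN]
        simpa using schurH_zero a s
      simp only [of_apply, Fin.val_last, h0, ← two_mul, pow_mul]
      simp only [Fin.succAbove_last]
      simp
      rfl
    · intro j _ hj
      have : (j : ℕ) < N := Fin.val_lt_last hj
      rw [of_apply, Fin.val_last, hzero N hN, schurH_of_neg]
      · simp
      · push_cast
        omega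
    · simp

/-- The Schur function of a Maya diagram `m` containing all integers up to `b` is, up to a constant
sign, the Wronskian type determinant on the elements of `m` above `b`, enumerated in any order. -/
theorem exists_sign_eval_schurS_mayaPartition {m : Set ℤ} (hm : IsMaya m) {b : ℤ}
    (hb : ∀ x ≤ b, x ∈ m) {N : ℕ} {r : Fin N → ℤ} (hr : Function.Injective r)
    (hrange : Set.range r = {x | x ∈ m ∧ b < x}) :
    ∃ ε : ℂ, ε * ε = 1 ∧ ∀ a s, MvPolynomial.eval (specPoint a s) (schurS (mayaPartition m)) =
      ε * (tauMatrix (fun i => r i - b - 1) a s).det := by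
  obtain ⟨h1, h2, h3, h4, -⟩ := mayaPartition_spec hm
  have hmem : ∀ x, x ∈ m ↔ ∃ i, mayaSeq m i = x := fun x => by rw [← Set.mem_range, h2]
  obtain ⟨k, hk⟩ := (hmem b).1 (hb b le_rfl)
  have hq : Set.range (fun i : Fin k => mayaSeq m i) = {x | x ∈ m ∧ b < x} := by
    ext x
    simp only [Set.mem_range, Set.mem_ofPred_eq, hmem, ← hk]
    constructor
    · rintro ⟨i, rfl⟩
      exact ⟨⟨i, rfl⟩, h1 i.2⟩
    · rintro ⟨⟨i, rfl⟩, h⟩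
      exact ⟨⟨i, h1.lt_iff_gt.1 h⟩, rfl⟩
  have hqinj : Function.Injective (fun i : Fin k => mayaSeq m i) := fun i j h =>
    Fin.ext (h1.injective h)
  let e : Fin N ≃ Fin k := (Equiv.ofInjective r hr).trans
    ((Equiv.setCongr (hrange.trans hq.symm)).trans (Equiv.ofInjective _ hqinj).symm)
  have he : ∀ i, mayaSeq m (e i) = r i := by
    intro i
    have := Equiv.apply_ofInjective_symm hqinj
      (Equiv.setCongr (hrange.trans hq.symm) (Equiv.ofInjective r hr i))
    exact this
  obtain rfl : N = k := by simpa using Fintype.card_congr e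
  have hlam : mayaPartition m N = 0 := by
    rw [mayaPartition, hk]
    convert Set.ncard_empty ℤ
    ext x
    simp only [Set.mem_ofPred_eq, Set.mem_empty_iff_false, iff_false, not_and, not_lt]
    exact fun hx => le_of_not_ge fun h => hx (hb x h)
  -- The charge of `m` is `b + N`.
  have hcharge : ∀ i, mayaSeq m i - mayaPartition m i + i = b + N := by
    have hstep : ∀ i, mayaSeq m i - mayaPartition m i + i = mayaSeq m 0 - mayaPartition m 0 := by
      intro i
      induction i with
      | zero => simp
      | succ i ih =>
        have := h4 i
        push_cast
        omega
    intro i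
    have := hstep i
    have := hstep N
    rw [hk, hlam] at this
    push_cast at this
    omega
  -- `ε₁` reverses the order of the columns, `ε₂` sorts the rows.
  let ε₁ : ℤˣ := Equiv.Perm.sign (Fin.revPerm : Equiv.Perm (Fin N))
  let ε₂ : ℤˣ := Equiv.Perm.sign e
  refine ⟨((ε₁ * ε₂ : ℤˣ) : ℤ), ?_, fun a s => ?_⟩
  · rw [← Int.cast_mul, ← Units.val_mul, Int.units_mul_self]
    simp
  · rw [eval_schurS_eq_det h3 hlam]
    have hmat : tauMatrix (fun i => r i - b - 1) a s = ((Matrix.of fun i j : Fin N =>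
        schurH ((mayaPartition m i : ℤ) - (i : ℕ) + (j : ℕ)) a s).submatrix id Fin.revPerm).submatrix
          e id := by
      ext i j
      simp only [tauMatrix, of_apply, submatrix_apply, id, Fin.revPerm_apply, Fin.val_rev]
      congr 1
      have := hcharge (e i)
      rw [he] at this
      have := j.2
      omega
    rw [hmat, det_permute, det_permute', ← mul_assoc, ← mul_assoc]
    have hε : (((ε₁ * ε₂ : ℤˣ) : ℤ) : ℂ) * ((ε₂ : ℤ) : ℂ) * ((ε₁ : ℤ) : ℂ) = 1 := by
      rw [← Int.cast_mul, ← Int.cast_mul, ← Units.val_mul, ← Units.val_mul, mul_assoc, mul_comm ε₂,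
        Int.units_mul_self]
      simp
    rw [hε, one_mul]

end Maya

/-! ### Nonvanishing -/

section Nonvanishing

open Matrix

theorem exists_polynomial_schurH (n : ℤ) (a : ℂ) :
    ∃ P : Polynomial ℂ, ∀ s, schurH n a s = P.eval s := by
  rcases lt_or_ge n 0 with hn | hn
  · exact ⟨0, fun s => by simp [schurH_of_neg hn]⟩
  lift n to ℕ using hn
  refine ⟨∑ p ∈ Finset.HasAntidiagonal.antidiagonal n,
    Polynomial.C (negBinom a p.2 / (p.1.factorial : ℂ)) * Polynomial.X ^ p.1, fun s => ?_⟩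
  rw [schurH_natCast_eq_sum, Polynomial.eval_finsetSum]
  refine Finset.sum_congr rfl fun p _ => ?_
  simp
  ring

/-- The reversed polynomial `t^n h_n(a, 1/t)`. -/
noncomputable def revSchurH (n : ℤ) (a t : ℂ) : ℂ :=
  if n < 0 then 0 else ∑ p ∈ Finset.HasAntidiagonal.antidiagonal n.toNat,
    t ^ p.2 / (p.1.factorial : ℂ) * negBinom a p.2

theorem revSchurH_eq (n : ℤ) (a : ℂ) {t : ℂ} (ht : t ≠ 0) :
    revSchurH n a t = t ^ n * schurH n a t⁻¹ := by
  rcases lt_or_ge n 0 with hn | hn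
  · simp [schurH_of_neg hn, revSchurH, hn]
  lift n to ℕ using hn
  rw [schurH_natCast_eq_sum, revSchurH, if_neg (by omega), Int.toNat_natCast, Finset.mul_sum]
  refine Finset.sum_congr rfl fun p hp => ?_
  rw [Finset.HasAntidiagonal.mem_antidiagonal] at hp
  rw [← hp, zpow_natCast, pow_add, inv_pow]
  field_simp

theorem continuous_revSchurH (n : ℤ) (a : ℂ) : Continuous (revSchurH n a) := by
  unfold revSchurH
  split_ifs
  · exact continuous_const
  · fun_prop

theorem revSchurH_zero (u j : ℕ) (a : ℂ) :
    revSchurH ((u : ℤ) - j) a 0 = (u.factorial : ℂ)⁻¹ * (u.descFactorial j : ℂ) := by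
  rcases lt_or_ge u j with h | h
  · rw [revSchurH, if_pos (by omega), Nat.descFactorial_of_lt h]
    simp
  · rw [revSchurH, if_neg (by omega), ← Nat.cast_sub h, Int.toNat_natCast,
      Finset.sum_eq_single (u - j, 0)]
    · have h1 : (u.factorial : ℂ) = (u - j).factorial * u.descFactorial j := by
        exact_mod_cast (Nat.factorial_mul_descFactorial h).symm
      have h2 : ((u - j).factorial : ℂ) ≠ 0 := by exact_mod_cast (u - j).factorial_ne_zero
      have h3 : (u.descFactorial j : ℂ) ≠ 0 := by
        exact_mod_cast fun h0 => absurd (Nat.descFactorial_eq_zero_iff_lt.1 h0) (by omega)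
      rw [h1]
      simp [negBinom]
      field_simp
    · intro p hp hne
      rw [Finset.HasAntidiagonal.mem_antidiagonal] at hp
      have : p.2 ≠ 0 := fun h0 => hne (Prod.ext (by simp; omega) h0)
      simp [this]
    · simp

/-- The determinant of the leading coefficients `1 / (u - j)!`, a Vandermonde determinant. -/
theorem det_revSchurH_zero_ne_zero {N : ℕ} {u : Fin N → ℕ} (hu : Function.Injective u) (a : ℂ) :
    (of fun i j : Fin N => revSchurH ((u i : ℤ) - (j : ℕ)) a 0).det ≠ 0 := by
  simp only [revSchurH_zero]
  have h1 := det_mul_column (fun i => ((u i).factorial : ℂ)⁻¹)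
    (of fun i j : Fin N => ((u i).descFactorial j : ℂ))
  simp only [of_apply] at h1
  rw [h1]
  refine mul_ne_zero (Finset.prod_ne_zero_iff.2 fun i _ =>
    inv_ne_zero (by exact_mod_cast (u i).factorial_ne_zero)) ?_
  have h2 := det_eval_matrixOfPolynomials_eq_det_vandermonde (fun i => (u i : ℂ))
    (fun j : Fin N => descPochhammer ℂ j) (fun j => descPochhammer_natDegree ℂ j)
    (fun j => monic_descPochhammer ℂ j)
  simp only [descPochhammer_eval_eq_descFactorial] at h2
  rw [← h2, det_vandermonde_ne_zero_iff]
  exact fun i j h => hu (Nat.cast_injective (R := ℂ) h)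

/-- As a function of `s`, the determinant is a polynomial whose leading coefficient is the
determinant of the leading coefficients; the latter is reached by letting `s` tend to infinity. -/
theorem exists_polynomial_det_tauMatrix {N : ℕ} {u : Fin N → ℤ} (hu : Function.Injective u)
    (hu0 : ∀ i, 0 ≤ u i) (a : ℂ) :
    ∃ P : Polynomial ℂ, P ≠ 0 ∧ ∀ s, (tauMatrix u a s).det = P.eval s := by
  choose H hH using fun n => exists_polynomial_schurH n a
  have hP : ∀ s, (tauMatrix u a s).det =
      (of fun i j : Fin N => H (u i - (j : ℕ))).det.eval s := by
    intro s
    rw [← Polynomial.coe_evalRingHom, RingHom.map_det]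
    congr 1
    ext i j
    simp [tauMatrix, hH]
  refine ⟨_, fun h0 => ?_, hP⟩
  have hzero : ∀ s, (tauMatrix u a s).det = 0 := fun s => by rw [hP, h0, Polynomial.eval_zero]
  have hcont : Continuous fun t => (of fun i j : Fin N => revSchurH (u i - (j : ℕ)) a t).det :=
    Continuous.matrix_det (continuous_matrix fun i j => continuous_revSchurH _ a)
  have hall := Continuous.ext_on (dense_compl_singleton (0 : ℂ)) hcont
    (continuous_const (y := (0 : ℂ))) (by
    intro t ht
    have ht : t ≠ 0 := ht
    have h1 := det_mul_column (fun i => t ^ u i) (of fun i j : Fin N =>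
      t ^ (-((j : ℕ) : ℤ)) * tauMatrix u a t⁻¹ i j)
    have h2 := det_mul_row (fun j : Fin N => t ^ (-((j : ℕ) : ℤ))) (tauMatrix u a t⁻¹)
    rw [h2, hzero, mul_zero, mul_zero] at h1
    refine Eq.trans ?_ h1
    refine congrArg Matrix.det (Matrix.ext fun i j => ?_)
    simp only [of_apply, tauMatrix]
    rw [revSchurH_eq _ _ ht, sub_eq_add_neg, zpow_add₀ ht, mul_assoc])
  lift u to Fin N → ℕ using hu0
  exact det_revSchurH_zero_ne_zero (fun i j h => hu (by simpa using h)) a (congrFun hall 0)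

end Nonvanishing

/-! ### The Maya diagrams of core partitions -/

section Core

variable {ℓ : ℕ}

theorem exists_eq_mul_add (hℓ : ℓ ≠ 0) (x : ℤ) :
    ∃ q : ℤ, ∃ i ∈ Finset.Icc 1 ℓ, x = (ℓ : ℤ) * q + (i : ℤ) := by
  have hpos : (0 : ℤ) < ℓ := by exact_mod_cast Nat.pos_of_ne_zero hℓ
  have h0 := Int.emod_nonneg (x - 1) hpos.ne'
  have h1 := Int.emod_lt_of_pos (x - 1) hpos
  have h2 := Int.mul_ediv_add_emod (x - 1) ℓ
  refine ⟨(x - 1) / ℓ, ((x - 1) % ℓ).toNat + 1, ?_, ?_⟩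
  · rw [Finset.mem_Icc]
    omega
  · push_cast
    omega

theorem mul_add_inj {q q' : ℤ} {i i' : ℕ} (hi : i ∈ Finset.Icc 1 ℓ) (hi' : i' ∈ Finset.Icc 1 ℓ)
    (h : (ℓ : ℤ) * q + i = ℓ * q' + i') : q = q' ∧ i = i' := by
  rw [Finset.mem_Icc] at hi hi'
  have hq : q = q' := by
    rcases lt_trichotomy q q' with hlt | heq | hlt
    · nlinarith [mul_le_mul_of_nonneg_left (show q + 1 ≤ q' by omega) (show (0 : ℤ) ≤ ℓ by omega)]
    · exact heq
    · nlinarith [mul_le_mul_of_nonneg_left (show q' + 1 ≤ q by omega) (show (0 : ℤ) ≤ ℓ by omega)]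
  subst hq
  exact ⟨rfl, by omega⟩

theorem mem_coreMaya_iff (ν : ZMod ℓ → ℤ) {i : ℕ} (hi : i ∈ Finset.Icc 1 ℓ) (q : ℤ) :
    (ℓ : ℤ) * q + i ∈ coreMaya ν ↔ q < ν (i : ZMod ℓ) := by
  constructor
  · rintro ⟨i', hi', q', hq', h⟩
    obtain ⟨rfl, rfl⟩ := mul_add_inj hi hi' h
    exact hq'
  · exact fun h => ⟨i, hi, q, h, rfl⟩

theorem nuShift_natCast (ν : ZMod ℓ → ℤ) {n : ℕ} (hn : n ≤ ℓ) {i : ℕ} (hi : i ∈ Finset.Icc 1 ℓ) :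
    nuShift ν n (i : ZMod ℓ) = ν (i : ZMod ℓ) + if i ≤ n then 1 else 0 := by
  have h : (∃ j ∈ Finset.Icc 1 n, (j : ZMod ℓ) = (i : ZMod ℓ)) ↔ i ≤ n := by
    constructor
    · rintro ⟨j, hj, h⟩
      have hj' : j ∈ Finset.Icc 1 ℓ := by
        rw [Finset.mem_Icc] at hj ⊢
        omega
      obtain ⟨c, hc⟩ := (Int.modEq_iff_dvd.1 ((ZMod.intCast_eq_intCast_iff (j : ℤ) i ℓ).1
        (by exact_mod_cast h)))
      have h1 := (mul_add_inj (q := c) (q' := 0) hj' hi (by rw [← hc]; ring)).2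
      rw [Finset.mem_Icc] at hj
      omega
    · intro h
      rw [Finset.mem_Icc] at hi
      exact ⟨i, Finset.mem_Icc.2 ⟨hi.1, h⟩, rfl⟩
  classical
  simp only [nuShift, h]

theorem nuSum_nuShift (ν : ZMod ℓ → ℤ) {n : ℕ} (hn : n ≤ ℓ) :
    nuSum (nuShift ν n) = nuSum ν + n := by
  rw [nuSum, Finset.sum_congr rfl fun i hi => nuShift_natCast ν hn hi, Finset.sum_add_distrib,
    ← nuSum, Finset.sum_boole]
  congr 2
  have : {i ∈ Finset.Icc 1 ℓ | i ≤ n} = Finset.Icc 1 n := by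
    ext i
    simp only [Finset.mem_filter, Finset.mem_Icc]
    omega
  rw [this, Nat.card_Icc, Nat.add_sub_cancel]

/-- Passing from `ν(n)` to `ν(n+1)` adds one element to the Maya diagram. -/
theorem coreMaya_nuShift_succ (ν : ZMod ℓ → ℤ) {n : ℕ} (hn : n < ℓ) :
    coreMaya (nuShift ν (n + 1)) =
      insert ((ℓ : ℤ) * ν ((n + 1 : ℕ) : ZMod ℓ) + (n + 1 : ℕ)) (coreMaya (nuShift ν n)) := by
  have hmem : n + 1 ∈ Finset.Icc 1 ℓ := Finset.mem_Icc.2 ⟨by omega, by omega⟩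
  ext x
  obtain ⟨q, i, hi, rfl⟩ := exists_eq_mul_add (ℓ := ℓ) (by omega) x
  have h : (ℓ : ℤ) * q + i = ℓ * ν ((n + 1 : ℕ) : ZMod ℓ) + (n + 1 : ℕ) ↔
      q = ν ((n + 1 : ℕ) : ZMod ℓ) ∧ i = n + 1 :=
    ⟨mul_add_inj hi hmem, by rintro ⟨rfl, rfl⟩; rfl⟩
  rw [Set.mem_insert_iff, h, mem_coreMaya_iff _ hi, mem_coreMaya_iff _ hi,
    nuShift_natCast (n := n + 1) ν (by omega) hi, nuShift_natCast (n := n) ν (by omega) hi]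
  rcases eq_or_ne i (n + 1) with rfl | hne
  · rw [if_pos le_rfl, if_neg (by omega)]
    omega
  · have : i ≤ n + 1 ↔ i ≤ n := by omega
    simp [hne, this]

theorem notMem_coreMaya_nuShift (ν : ZMod ℓ → ℤ) {n : ℕ} (hn : n < ℓ) :
    (ℓ : ℤ) * ν ((n + 1 : ℕ) : ZMod ℓ) + (n + 1 : ℕ) ∉ coreMaya (nuShift ν n) := by
  have hmem : n + 1 ∈ Finset.Icc 1 ℓ := Finset.mem_Icc.2 ⟨by omega, by omega⟩
  rw [mem_coreMaya_iff _ hmem, nuShift_natCast ν (by omega) hmem]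
  simp

theorem nuShift_zero (ν : ZMod ℓ → ℤ) : nuShift ν 0 = ν := by
  funext i
  simp [nuShift]

/-- Adding one to all entries of `ν` translates the Maya diagram by `ℓ`, which does not change the
partition. -/
theorem corePartition_nuShift_self (hℓ : ℓ ≠ 0) (ν : ZMod ℓ → ℤ) :
    corePartition (nuShift ν ℓ) = corePartition ν := by
  rw [corePartition, corePartition, ← mayaPartition_image_add (isMaya_coreMaya hℓ ν) ℓ]
  congr 1
  ext x
  obtain ⟨q, i, hi, rfl⟩ := exists_eq_mul_add hℓ x
  have h : (ℓ : ℤ) * q + i ∈ (fun x => x + (ℓ : ℤ)) '' coreMaya ν ↔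
      (ℓ : ℤ) * (q - 1) + i ∈ coreMaya ν := by
    constructor
    · rintro ⟨y, hy, h⟩
      rwa [show (ℓ : ℤ) * (q - 1) + i = y by simp only at h; linarith]
    · exact fun h => ⟨_, h, by ring⟩
  rw [h, mem_coreMaya_iff _ hi, mem_coreMaya_iff _ hi, nuShift_natCast ν le_rfl hi,
    if_pos (Finset.mem_Icc.1 hi).2]
  omega

/-- The number of elements of the Maya diagram above `ℓ B`, that is, its charge relative to `ℓ B`. -/
theorem exists_enumeration_coreMaya (ν : ZMod ℓ → ℤ) {B : ℤ}
    (hB : ∀ i, B ≤ ν i) {N : ℕ} (hN : (N : ℤ) = nuSum ν - ℓ * B) :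
    ∃ r : Fin N → ℤ, Function.Injective r ∧ Set.range r = {x | x ∈ coreMaya ν ∧ ℓ * B < x} := by
  let F : Finset ((_ : ℕ) × ℤ) := (Finset.Icc 1 ℓ).sigma fun i => Finset.Ico B (ν (i : ZMod ℓ))
  have hcard : F.card = N := by
    have : (F.card : ℤ) = N := by
      rw [Finset.card_sigma, hN, nuSum]
      push_cast
      rw [Finset.sum_congr rfl fun i _ => by
        rw [Int.card_Ico, Int.toNat_of_nonneg (sub_nonneg.2 (hB i))], Finset.sum_sub_distrib]
      simp
    exact_mod_cast this
  let e := (F.equivFinOfCardEq hcard).symm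
  have hval : ∀ p : F, p.1.1 ∈ Finset.Icc 1 ℓ ∧ B ≤ p.1.2 ∧ p.1.2 < ν (p.1.1 : ZMod ℓ) := by
    intro p
    have := p.2
    simp only [F, Finset.mem_sigma, Finset.mem_Ico] at this
    exact this
  refine ⟨fun j => (ℓ : ℤ) * (e j).1.2 + (e j).1.1, ?_, ?_⟩
  · intro j j' h
    obtain ⟨h1, h2⟩ := mul_add_inj (hval (e j)).1 (hval (e j')).1 h
    exact e.injective (Subtype.ext (Sigma.ext h2 (heq_of_eq h1)))
  · ext x
    simp only [Set.mem_range, Set.mem_ofPred_eq]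
    constructor
    · rintro ⟨j, rfl⟩
      obtain ⟨h1, h2, h3⟩ := hval (e j)
      refine ⟨(mem_coreMaya_iff ν h1 _).2 h3, ?_⟩
      have := mul_le_mul_of_nonneg_left h2 (show (0 : ℤ) ≤ ℓ by omega)
      rw [Finset.mem_Icc] at h1
      omega
    · rintro ⟨⟨i, hi, q, hq, rfl⟩, h⟩
      have hBq : B ≤ q := by
        by_contra hlt
        have := mul_le_mul_of_nonneg_left (show q + 1 ≤ B by omega) (show (0 : ℤ) ≤ ℓ by omega)
        rw [Finset.mem_Icc] at hi
        nlinarith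
      refine ⟨e.symm ⟨⟨i, q⟩, ?_⟩, ?_⟩
      · simp only [F, Finset.mem_sigma, Finset.mem_Ico]
        exact ⟨hi, hBq, hq⟩
      · simp

theorem mem_coreMaya_of_le (hℓ : ℓ ≠ 0) (ν : ZMod ℓ → ℤ) {B : ℤ} (hB : ∀ i, B ≤ ν i) {x : ℤ}
    (hx : x ≤ ℓ * B) : x ∈ coreMaya ν := by
  obtain ⟨q, i, hi, rfl⟩ := exists_eq_mul_add hℓ x
  rw [mem_coreMaya_iff ν hi]
  refine lt_of_lt_of_le ?_ (hB i)
  rw [Finset.mem_Icc] at hi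
  by_contra hlt
  have := mul_le_mul_of_nonneg_left (show B ≤ q by omega) (show (0 : ℤ) ≤ ℓ by omega)
  omega

/-- The functions `σ_n` and `σ_{n+1}` are, up to constant signs, the Wronskian type determinants of a
sequence and of the same sequence with one more entry. -/
theorem exists_sigmaNat_eq_det (ν : ZMod ℓ → ℤ) {n : ℕ} (hn : n < ℓ) :
    ∃ (N : ℕ) (u : Fin (N + 1) → ℤ) (w : ℤ) (ε ε' : ℂ),
      Function.Injective u ∧ (∀ i, 0 ≤ u i) ∧ ε * ε = 1 ∧ ε' * ε' = 1 ∧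
      w - (N + 1 : ℕ) = ℓ * ν ((n + 1 : ℕ) : ZMod ℓ) - nuSum ν ∧
      (∀ a s, sigmaNat ν n a s = ε * (tauMatrix u a s).det) ∧
      (∀ a s, sigmaNat ν (n + 1) a s =
        ε' * (tauMatrix (Fin.snoc u w : Fin (N + 2) → ℤ) a s).det) := by
  have hℓ : ℓ ≠ 0 := by omega
  have : NeZero ℓ := ⟨hℓ⟩
  -- One more than a bare lower bound, so that the sequence `u` is not empty.
  obtain ⟨B, hB⟩ : ∃ B, ∀ i, B + 1 ≤ ν i := by
    obtain ⟨B, hB⟩ := (Set.finite_range ν).bddBelow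
    exact ⟨B - 1, fun i => by simpa using hB ⟨i, rfl⟩⟩
  have hνle : ∀ k i, ν i ≤ nuShift ν k i := by
    intro k i
    classical
    simp only [nuShift]
    split_ifs <;> omega
  have hB1 : ∀ k i, B ≤ nuShift ν k i := fun k i => by
    have := hB i
    have := hνle k i
    omega
  have hpos : (ℓ : ℤ) * (B + 1) ≤ nuSum ν := by
    have h := Finset.card_nsmul_le_sum (Finset.Icc 1 ℓ) (fun i => ν (i : ZMod ℓ)) (B + 1)
      fun i _ => hB i
    simpa [nuSum] using h
  obtain ⟨N, hN⟩ : ∃ N : ℕ, ((N + 1 : ℕ) : ℤ) = nuSum (nuShift ν n) - ℓ * B := by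
    refine ⟨(nuSum (nuShift ν n) - ℓ * B - 1).toNat, ?_⟩
    rw [nuSum_nuShift ν hn.le]
    have : (ℓ : ℤ) * (B + 1) = ℓ * B + ℓ := by ring
    omega
  obtain ⟨r, hr, hrange⟩ := exists_enumeration_coreMaya (nuShift ν n) (hB1 n) hN
  set x : ℤ := (ℓ : ℤ) * ν ((n + 1 : ℕ) : ZMod ℓ) + (n + 1 : ℕ) with hx
  have hxB : (ℓ : ℤ) * B < x := by
    have := mul_le_mul_of_nonneg_left (hB ((n + 1 : ℕ) : ZMod ℓ)) (show (0 : ℤ) ≤ ℓ by omega)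
    have : (ℓ : ℤ) * (B + 1) = ℓ * B + ℓ := by ring
    omega
  have hrx : x ∉ Set.range r := by
    rw [hrange]
    exact fun h => notMem_coreMaya_nuShift ν hn h.1
  have hr' : Function.Injective (Fin.snoc r x : Fin (N + 2) → ℤ) :=
    Fin.snoc_injective_of_injective hr hrx
  have hrange' : Set.range (Fin.snoc r x : Fin (N + 2) → ℤ) =
      {y | y ∈ coreMaya (nuShift ν (n + 1)) ∧ ℓ * B < y} := by
    rw [Fin.range_snoc, hrange, coreMaya_nuShift_succ ν hn]
    ext y
    simp only [Set.mem_insert_iff, Set.mem_ofPred_eq]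
    constructor
    · rintro (rfl | h)
      · exact ⟨Or.inl rfl, hxB⟩
      · exact ⟨Or.inr h.1, h.2⟩
    · rintro ⟨rfl | h, h2⟩
      · exact Or.inl rfl
      · exact Or.inr ⟨h, h2⟩
  obtain ⟨ε, hε, h1⟩ := exists_sign_eval_schurS_mayaPartition (isMaya_coreMaya hℓ (nuShift ν n))
    (fun y hy => mem_coreMaya_of_le hℓ _ (hB1 n) hy) hr hrange
  obtain ⟨ε', hε', h2⟩ := exists_sign_eval_schurS_mayaPartition
    (isMaya_coreMaya hℓ (nuShift ν (n + 1)))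
    (fun y hy => mem_coreMaya_of_le hℓ _ (hB1 (n + 1)) hy) hr' hrange'
  refine ⟨N, fun i => r i - ℓ * B - 1, x - ℓ * B - 1, ε, ε', fun i j h => hr (by simpa using h),
    fun i => ?_, hε, hε', ?_, h1, fun a s => ?_⟩
  · have : r i ∈ Set.range r := ⟨i, rfl⟩
    rw [hrange] at this
    have := this.2
    show 0 ≤ r i - ℓ * B - 1
    omega
  · rw [hN, nuSum_nuShift ν hn.le, hx]
    push_cast
    ring
  · rw [sigmaNat, corePartition, h2]
    congr 3
    funext i
    induction i using Fin.lastCases <;> simp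

end Core

/-! ### From the bilinear equations to the chain -/

section Chain

variable {ℓ : ℕ}

theorem hirotaD_eq {f g : ℂ → ℂ} (hf : Differentiable ℂ f) (hg : Differentiable ℂ g) (s : ℂ) :
    hirotaD f g s = deriv f s * g s - f s * deriv g s := by
  have h1 : HasDerivAt (fun ε => f (s + ε)) (deriv f s) 0 := by
    simpa using (HasDerivAt.comp_const_add s 0 (by simpa using (hf s).hasDerivAt))
  have h2 : HasDerivAt (fun ε => g (s - ε)) (-deriv g s) 0 := by
    simpa using (HasDerivAt.comp_const_sub s 0 (by simpa using (hg s).hasDerivAt))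
  rw [hirotaD, (h1.fun_mul h2).deriv]
  simp
  ring

/-- The two bilinear equations imply the chain: each chain equation is a linear combination of four,
respectively two, bilinear ones. -/
theorem solvesP3ChainAt_of_bilinear (σ : ZMod ℓ → ℂ → ℂ → ℂ) (c : ZMod ℓ → ℂ)
    (hσ : ∀ n a, Differentiable ℂ (σ n a))
    (h₁ : ∀ n a s, hirotaD (σ n (a - 1)) (σ (n + 1) a) s + σ n (a - 1) s * σ (n + 1) a s
      - σ n a s * σ (n + 1) (a - 1) s = 0)
    (h₂ : ∀ n a s, s * hirotaD (σ n a) (σ (n + 1) a) s + (a + c n) * (σ n a s * σ (n + 1) a s)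
      - a * (σ n (a - 1) s * σ (n + 1) (a + 1) s) = 0)
    {a s : ℂ} (hne : ∀ n, σ n a s ≠ 0 ∧ σ n (a - 1) s ≠ 0) :
    SolvesP3ChainAt a (fun n => c n - c (n - 1) + 1) (chainF σ a) (chainG σ a) s := by
  intro n
  have hd : ∀ k b, HasDerivAt (σ k b) (deriv (σ k b) s) s := fun k b => (hσ k b s).hasDerivAt
  have hF := ((hd (n - 1) a).mul (hd n (a - 1))).div ((hd (n - 1) (a - 1)).mul (hd n a))
    (mul_ne_zero (hne _).2 (hne _).1)
  have hG := ((hd (n - 1) (a - 1)).mul (hd n (a + 1))).div ((hd (n - 1) a).mul (hd n a))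
    (mul_ne_zero (hne _).1 (hne _).1)
  have e1 := h₁ (n - 1) a s
  have e2 := h₁ n a s
  have e3 := h₁ (n - 1) (a + 1) s
  have e4 := h₂ (n - 1) a s
  have e5 := h₂ n a s
  rw [hirotaD_eq (hσ _ _) (hσ _ _)] at e1 e2 e3 e4 e5
  rw [sub_add_cancel] at e1 e3 e4
  rw [add_sub_cancel_right] at e3
  have hFd : deriv (chainF σ a n) s = _ := hF.deriv
  have hGd : deriv (chainG σ a n) s = _ := hG.deriv
  refine ⟨hF.differentiableAt, hG.differentiableAt, ?_, ?_⟩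
  · rw [hFd]
    simp only [chainF, chainG, add_sub_cancel_right, Pi.mul_apply]
    obtain ⟨n1, n2⟩ := hne (n - 1)
    obtain ⟨n3, n4⟩ := hne n
    obtain ⟨n5, n6⟩ := hne (n + 1)
    generalize σ (n - 1) a s = P, σ (n - 1) (a - 1) s = P1, σ n a s = Q, σ n (a - 1) s = Q1,
      σ (n + 1) a s = R, σ (n + 1) (a - 1) s = R1 at *
    linear_combination (norm := (field_simp; ring))
      (P * Q1 / (P1 * Q)) * ((s / (Q1 * R)) * e2 - (s / (P1 * Q)) * e1 + 1 / (P * Q) * e4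
        - 1 / (Q * R) * e5)
  · rw [hGd]
    simp only [chainF, chainG, Pi.mul_apply]
    obtain ⟨n1, n2⟩ := hne (n - 1)
    obtain ⟨n3, n4⟩ := hne n
    obtain ⟨n5, n6⟩ := hne (n - 1 - 1)
    generalize σ (n - 1) a s = P, σ (n - 1) (a - 1) s = P1, σ n a s = Q, σ n (a - 1) s = Q1,
      σ (n - 1 - 1) a s = O, σ (n - 1 - 1) (a - 1) s = O1 at *
    linear_combination (norm := (field_simp; ring))
      (σ n (a + 1) s / (P * Q ^ 2)) * e1 - (P1 / (P ^ 2 * Q)) * e3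

end Chain

/-! ### The sequence `σ_n` -/

section Sigma

variable {ℓ : ℕ}

theorem sigmaNat_self_eq_sigmaNat_zero (hℓ : ℓ ≠ 0) (ν : ZMod ℓ → ℤ) :
    sigmaNat ν ℓ = sigmaNat ν 0 := by
  funext a s
  rw [sigmaNat, sigmaNat, corePartition_nuShift_self hℓ, nuShift_zero]

theorem sigma_add_one [NeZero ℓ] (ν : ZMod ℓ → ℤ) (n : ZMod ℓ) :
    sigma ν (n + 1) = sigmaNat ν (n.val + 1) := by
  funext a s
  have hlt := ZMod.val_lt n
  have hval : (n + 1).val = (n.val + 1) % ℓ := by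
    rw [← ZMod.val_natCast]
    simp
  rw [sigma, hval]
  rcases Nat.lt_or_ge (n.val + 1) ℓ with h | h
  · rw [Nat.mod_eq_of_lt h]
  · rw [show n.val + 1 = ℓ by omega, Nat.mod_self,
      sigmaNat_self_eq_sigmaNat_zero (NeZero.ne ℓ)]

theorem exists_sigma_eq_det [NeZero ℓ] (ν : ZMod ℓ → ℤ) (n : ZMod ℓ) :
    ∃ (N : ℕ) (u : Fin (N + 1) → ℤ) (w : ℤ) (ε ε' : ℂ),
      Function.Injective u ∧ (∀ i, 0 ≤ u i) ∧ ε * ε = 1 ∧ ε' * ε' = 1 ∧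
      w - (N + 1 : ℕ) = ℓ * ν (n + 1) - nuSum ν ∧
      (∀ a s, sigma ν n a s = ε * (tauMatrix u a s).det) ∧
      (∀ a s, sigma ν (n + 1) a s =
        ε' * (tauMatrix (Fin.snoc u w : Fin (N + 2) → ℤ) a s).det) := by
  obtain ⟨N, u, w, ε, ε', h1, h2, h3, h4, h5, h6, h7⟩ := exists_sigmaNat_eq_det ν (ZMod.val_lt n)
  refine ⟨N, u, w, ε, ε', h1, h2, h3, h4, ?_, h6, ?_⟩
  · rw [h5]
    simp
  · rw [sigma_add_one]
    exact h7

theorem exists_polynomial_sigma [NeZero ℓ] (ν : ZMod ℓ → ℤ) (n : ZMod ℓ) (a : ℂ) :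
    ∃ P : Polynomial ℂ, P ≠ 0 ∧ ∀ s : ℂ, sigma ν n a s = P.eval s := by
  obtain ⟨N, u, w, ε, ε', hu, hu0, hε, -, -, h, -⟩ := exists_sigma_eq_det ν n
  obtain ⟨P, hP, hPs⟩ := exists_polynomial_det_tauMatrix hu hu0 a
  refine ⟨Polynomial.C ε * P, mul_ne_zero (Polynomial.C_ne_zero.2 (left_ne_zero_of_mul_eq_one hε)) hP,
    fun s => ?_⟩
  rw [h, hPs, Polynomial.eval_C_mul]

theorem differentiable_sigma [NeZero ℓ] (ν : ZMod ℓ → ℤ) (n : ZMod ℓ) (a : ℂ) :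
    Differentiable ℂ (sigma ν n a) := by
  obtain ⟨P, -, hP⟩ := exists_polynomial_sigma ν n a
  rw [show sigma ν n a = fun s => P.eval s from funext hP]
  exact P.differentiable

theorem sigma_bilinear_one [NeZero ℓ] (ν : ZMod ℓ → ℤ) (n : ZMod ℓ) (a s : ℂ) :
    hirotaD (sigma ν n (a - 1)) (sigma ν (n + 1) a) s + sigma ν n (a - 1) s * sigma ν (n + 1) a s
      - sigma ν n a s * sigma ν (n + 1) (a - 1) s = 0 := by
  rw [hirotaD_eq (differentiable_sigma ν n _) (differentiable_sigma ν (n + 1) _)]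
  obtain ⟨N, u, w, ε, ε', -, -, -, -, -, h, h'⟩ := exists_sigma_eq_det ν n
  rw [show sigma ν n (a - 1) = _ from funext (h (a - 1)),
    show sigma ν (n + 1) a = _ from funext (h' a), deriv_const_mul_field, deriv_const_mul_field, h, h']
  linear_combination ε * ε' * det_tauMatrix_bilinear_one u w a s

theorem sigma_bilinear_two [NeZero ℓ] (ν : ZMod ℓ → ℤ) (n : ZMod ℓ) (a s : ℂ) :
    s * hirotaD (sigma ν n a) (sigma ν (n + 1) a) s
      + (a + ((ℓ : ℂ) * ν (n + 1) - nuSum ν)) * (sigma ν n a s * sigma ν (n + 1) a s)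
      - a * (sigma ν n (a - 1) s * sigma ν (n + 1) (a + 1) s) = 0 := by
  rw [hirotaD_eq (differentiable_sigma ν n _) (differentiable_sigma ν (n + 1) _)]
  obtain ⟨N, u, w, ε, ε', -, -, -, -, hw, h, h'⟩ := exists_sigma_eq_det ν n
  have hw' : (w : ℂ) - (N + 1 : ℕ) = (ℓ : ℂ) * ν (n + 1) - nuSum ν := by exact_mod_cast hw
  rw [← hw', show sigma ν n a = _ from funext (h a),
    show sigma ν (n + 1) a = _ from funext (h' a), deriv_const_mul_field, deriv_const_mul_field, h, h']
  linear_combination ε * ε' * det_tauMatrix_bilinear_two u w a s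

theorem exists_forall_sub_eq [NeZero ℓ] (c : ZMod ℓ → ℂ)
    (hc : ∑ i ∈ Finset.range ℓ, c (i : ZMod ℓ) = 0) :
    ∃ d : ZMod ℓ → ℂ, ∀ n, d (n + 1) - d n = c n := by
  refine ⟨fun n => ∑ i ∈ Finset.range n.val, c (i : ZMod ℓ), fun n => ?_⟩
  have hlt := ZMod.val_lt n
  have hval : (n + 1).val = (n.val + 1) % ℓ := by
    rw [← ZMod.val_natCast]
    simp
  have hsucc := Finset.sum_range_succ (fun i : ℕ => c (i : ZMod ℓ)) n.val
  rw [ZMod.natCast_zmod_val] at hsucc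
  simp only [hval]
  rcases Nat.lt_or_ge (n.val + 1) ℓ with h | h
  · rw [Nat.mod_eq_of_lt h, hsucc]
    ring
  · have hn : n.val + 1 = ℓ := by omega
    rw [hn, hc] at hsucc
    rw [hn, Nat.mod_self, Finset.sum_range_zero]
    linear_combination hsucc

end Sigma

theorem mainTheorem3 (ℓ : ℕ) (hℓ : 2 ≤ ℓ) (ν : ZMod ℓ → ℤ) :
    -- the sequence is cyclic: `σ_ℓ = σ_0`
    sigmaNat ν ℓ = sigmaNat ν 0 ∧
    -- for every `a`, the function `σ_n(a, ·)` is a nonzero polynomial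
    (∀ (n : ZMod ℓ) (a : ℂ), ∃ P : Polynomial ℂ, P ≠ 0 ∧ ∀ s : ℂ, sigma ν n a s = P.eval s) ∧
    -- the first bilinear equation
    (∀ (n : ZMod ℓ) (a s : ℂ),
      hirotaD (sigma ν n (a - 1)) (sigma ν (n + 1) a) s
        + sigma ν n (a - 1) s * sigma ν (n + 1) a s
        - sigma ν n a s * sigma ν (n + 1) (a - 1) s = 0) ∧
    -- the second bilinear equation, for all constants `d_n` with the given differences, which exist
    (∃ d : ZMod ℓ → ℂ, ∀ n, d (n + 1) - d n = (ℓ : ℂ) * ν (n + 1) - nuSum ν) ∧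
    (∀ d : ZMod ℓ → ℂ, (∀ n, d (n + 1) - d n = (ℓ : ℂ) * ν (n + 1) - nuSum ν) →
      ∀ (n : ZMod ℓ) (a s : ℂ),
        s * hirotaD (sigma ν n a) (sigma ν (n + 1) a) s
          + (a + d (n + 1) - d n) * (sigma ν n a s * sigma ν (n + 1) a s)
          - a * (sigma ν n (a - 1) s * sigma ν (n + 1) (a + 1) s) = 0) ∧
    -- the rational solution of the chain, wherever the denominators do not vanish
    (∀ a s : ℂ, (∀ n : ZMod ℓ, sigma ν n a s ≠ 0 ∧ sigma ν n (a - 1) s ≠ 0) →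
      SolvesP3ChainAt a (fun n => (ℓ : ℂ) * (ν (n + 1) - ν n) + 1)
        (chainF (sigma ν) a) (chainG (sigma ν) a) s) := by
  have hℓ0 : ℓ ≠ 0 := by omega
  have : NeZero ℓ := ⟨hℓ0⟩
  refine ⟨sigmaNat_self_eq_sigmaNat_zero hℓ0 ν, exists_polynomial_sigma ν, sigma_bilinear_one ν,
    exists_forall_sub_eq _ ?_, ?_, fun a s hne => ?_⟩
  · have h : nuSum ν = ∑ i ∈ Finset.range ℓ, ν ((i : ZMod ℓ) + 1) := by
      rw [nuSum, Finset.range_eq_Ico, ← Finset.Ico_add_one_right_eq_Icc,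
        ← Finset.sum_Ico_add' (fun i : ℕ => ν (i : ZMod ℓ)) 0 ℓ 1]
      simp
    rw [Finset.sum_sub_distrib, ← Finset.mul_sum, h]
    simp
  · intro d hd n a s
    rw [add_sub_assoc a, hd]
    exact sigma_bilinear_two ν n a s
  · have h := solvesP3ChainAt_of_bilinear (sigma ν) (fun n => (ℓ : ℂ) * ν (n + 1) - nuSum ν)
      (differentiable_sigma ν) (sigma_bilinear_one ν) (sigma_bilinear_two ν) hne
    convert h using 3 with n
    rw [sub_add_cancel]
    ring
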